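/- Let $H$ be a real Hilbert space with a countable orthonormal basis $\{e_k\}$, and let $A$ be a self-adjoint operator on $H$ with domain $D(A)$ such that $e_k\in D(A)$ and $Ae_k=\lambda_k^2e_k$ for all $k$, where $\lambda_k\ge 0$. For $\alpha\ge 0$ let $D(A^\alpha)$ be the space of all $z\in H$ with $\sum_k\lambda_k^{4\alpha}\langle z,e_k\rangle^2<+\infty$, let $A^\alpha z=\sum_k\lambda_k^{2\alpha}\langle z,e_k\rangle e_k$ for $z\in D(A^\alpha)$, and give $D(A^\alpha)$ the graph norm $(|z|^2+|A^\alpha z|^2)^{1/2}$. Let $m:[0,+\infty)\to\mathbb{R}$ be of class $C^1$ with $m(\sigma)\ge\nu_0>0$ for all $\sigma\ge 0$. For $(u_0,u_1)\in D(A^{3/4})\times D(A^{1/4})$ consider the problem $$u''(t)+m\bigl(|A^{1/2}u(t)|^2\bigr)Au(t)=0,\qquad u(0)=u_0,\quad u'(0)=u_1 .\tag{1}$$ A solution on $I=[0,T]$ (with $T>0$) or $I=[0,+\infty)$ is a function $u\in C^0(I,D(A^{3/4}))\cap C^1(I,D(A^{1/4}))$ that satisfies the initial conditions and, for every $\varphi\in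 D(A)$ and $t\in I$, $\frac{d}{dt}\langle u'(t),\varphi\rangle=-m(|A^{1/2}u(t)|^2)\langle u(t),A\varphi\rangle$. It is global if $I=[0,+\infty)$. The life span $\mathcal{LS}(u_0,u_1)\in[0,+\infty]$ is the supremum of all $T>0$ such that (1) has a solution on $[0,T]$. Finally, let $$E_z(t):=|z'(t)|^2+|A^{1/4}z'(t)|^2+|A^{1/2}z(t)|^2+|A^{3/4}z(t)|^2 .$$ Suppose that, for some $(u_0,u_1)\in D(A^{3/4})\times D(A^{1/4})$, problem (1) has a global solution $u$, and let $\{(u_{0\varepsilon},u_{1\varepsilon})\}_{\varepsilon>0}\subseteq D(A^{3/4})\times D(A^{1/4})$ be a family that converges to $(u_0,u_1)$ in $D(A^{3/4})\times D(A^{1/4})$ as $\varepsilon\to0^+$. Then $$\lim_{\varepsilon\to0^+}\mathcal{LS}(u_{0\varepsilon},u_{1\varepsilon})=+\infty ,$$ and, denoting by $u_\varepsilon$ the solution with initial data $(u_{0\varepsilon},u_{1\varepsilon})$, $E_{(u_\varepsilon-u)}(t)\to0$ uniformly on all bounded time intervals. That is, for every $T>0$ and $\delta>0$ there is $\varepsilon_0>0$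 such that, for all $\varepsilon\in(0,\varepsilon_0)$, problem (1) with data $(u_{0\varepsilon},u_{1\varepsilon})$ has a solution on $[0,T]$, and every such solution $u_\varepsilon$ satisfies $E_{(u_\varepsilon-u)}(t)<\delta$ for all $t\in[0,T]$. -/

import Mathlib

open Set Filter Topology
open scoped ENNReal

namespace Kirchhoff

noncomputable section

/-- The domain `D(A^α)` of the power `A^α`, where `A` is the self-adjoint operator with
`A (e k) = (lam k)^2 • e k`: the vectors `z` with `∑ (lam k)^(4α) ⟨z, e k⟩² < ∞`. -/
def PowDomain {H ι : Type*} [NormedAddCommGroup H] [InnerProductSpace ℝ H]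
    (e : HilbertBasis ι ℝ H) (lam : ι → ℝ) (α : ℝ) : Set H :=
  {z | Summable fun k => lam k ^ (4 * α) * inner ℝ (e k) z ^ 2}

/-- The vector `A^α z = ∑ (lam k)^(2α) ⟨z, e k⟩ e k`, meaningful for `z ∈ D(A^α)`. -/
def pow {H ι : Type*} [NormedAddCommGroup H] [InnerProductSpace ℝ H]
    (e : HilbertBasis ι ℝ H) (lam : ι → ℝ) (α : ℝ) (z : H) : H :=
  ∑' k, (lam k ^ (2 * α) * inner ℝ (e k) z) • e k

/-- Convergence `f → z` along `l` in the space `D(A^α)`, with its graph norm. The membership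
of `f` and `z` in `D(A^α)` is stated separately. -/
def TendstoPow {H ι X : Type*} [NormedAddCommGroup H] [InnerProductSpace ℝ H]
    (e : HilbertBasis ι ℝ H) (lam : ι → ℝ) (α : ℝ) (f : X → H) (l : Filter X) (z : H) : Prop :=
  Tendsto f l (𝓝 z) ∧ Tendsto (fun x => pow e lam α (f x)) l (𝓝 (pow e lam α z))

/-- `f ∈ C⁰(I, D(A^α))`, where `D(A^α)` has the graph norm. -/
def IsC0Pow {H ι : Type*} [NormedAddCommGroup H] [InnerProductSpace ℝ H]
    (e : HilbertBasis ι ℝ H) (lam : ι → ℝ) (α : ℝ) (I : Set ℝ) (f : ℝ → H) : Prop :=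
  (∀ t ∈ I, f t ∈ PowDomain e lam α) ∧ ContinuousOn f I ∧
    ContinuousOn (fun t => pow e lam α (f t)) I

/-- `f ∈ C¹(I, D(A^α))` with derivative `f'`, where `D(A^α)` has the graph norm. -/
def IsC1Pow {H ι : Type*} [NormedAddCommGroup H] [InnerProductSpace ℝ H]
    (e : HilbertBasis ι ℝ H) (lam : ι → ℝ) (α : ℝ) (I : Set ℝ) (f f' : ℝ → H) : Prop :=
  (∀ t ∈ I, f t ∈ PowDomain e lam α) ∧ IsC0Pow e lam α I f' ∧
    (∀ t ∈ I, HasDerivWithinAt f (f' t) I t) ∧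
    ∀ t ∈ I, HasDerivWithinAt (fun s => pow e lam α (f s)) (pow e lam α (f' t)) I t

/-- `u`, with time derivative `v = u'`, belongs to `C⁰(I, D(A^{3/4})) ∩ C¹(I, D(A^{1/4}))`, has
initial data `u(0) = u₀`, `u'(0) = u₁`, and solves `u'' + m(|A^{1/2}u|²) A u = 0` on the time
interval `I`. Since `u(t)` need not lie in `D(A)`, the equation is tested against the vectors
`φ ∈ D(A)`: `(d/dt) ⟨u'(t), φ⟩ = - m(|A^{1/2}u(t)|²) ⟨u(t), A φ⟩`. -/
structure IsSolution {H ι : Type*} [NormedAddCommGroup H] [InnerProductSpace ℝ H]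
    (A : H →ₗ.[ℝ] H) (e : HilbertBasis ι ℝ H) (lam : ι → ℝ) (m : ℝ → ℝ)
    (u₀ u₁ : H) (I : Set ℝ) (u v : ℝ → H) : Prop where
  regular : IsC0Pow e lam (3 / 4) I u
  regular_deriv : IsC1Pow e lam (1 / 4) I u v
  init : u 0 = u₀
  init_deriv : v 0 = u₁
  equation : ∀ φ : A.domain, ∀ t ∈ I,
    HasDerivWithinAt (fun s => inner ℝ (v s) (φ : H))
      (-(m (‖pow e lam (1 / 2) (u t)‖ ^ 2) * inner ℝ (u t) (A φ))) I t

/-- The life span: the supremum (possibly `+∞`) of the times `T > 0` such that a solution with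
initial data `(u₀, u₁)` exists on `[0, T]`. -/
def lifeSpan {H ι : Type*} [NormedAddCommGroup H] [InnerProductSpace ℝ H]
    (A : H →ₗ.[ℝ] H) (e : HilbertBasis ι ℝ H) (lam : ι → ℝ) (m : ℝ → ℝ) (u₀ u₁ : H) : ℝ≥0∞ :=
  sSup {S | ∃ T : ℝ, 0 < T ∧ S = ENNReal.ofReal T ∧
    ∃ u v : ℝ → H, IsSolution A e lam m u₀ u₁ (Icc 0 T) u v}

/-- `E(z₀, z₁) = |z₁|² + |A^{1/4} z₁|² + |A^{1/2} z₀|² + |A^{3/4} z₀|²`. -/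
def energy {H ι : Type*} [NormedAddCommGroup H] [InnerProductSpace ℝ H]
    (e : HilbertBasis ι ℝ H) (lam : ι → ℝ) (z₀ z₁ : H) : ℝ :=
  ‖z₁‖ ^ 2 + ‖pow e lam (1 / 4) z₁‖ ^ 2 + ‖pow e lam (1 / 2) z₀‖ ^ 2 + ‖pow e lam (3 / 4) z₀‖ ^ 2

end

end Kirchhoff

namespace Kirchhoff

/-! The nonlinearity enters only through the scalar function `c(t) = m(|A^{1/2}u(t)|²)`. For a given
`c` the equation is linear and splits into the scalar equations `x'' + c λ_k² x = 0`, so solving the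
problem amounts to finding a fixed point of the map from `c` to `m(|A^{1/2}w|²)`, where `w` solves
the linear equation with coefficient `c` (`exists_isLinearSolution`).

The level 3/4, 1/4 of the data is the one at which this closes. Since `|A^{1/2}u|²` varies at rate
at most `2|A^{1/4}u'||A^{3/4}u|`, the coefficient is Lipschitz, and a Lipschitz coefficient
amplifies every mode energy by a factor independent of `λ_k` (`IsMode.energy_le`).

Comparing two coefficients loses a derivative: the difference of two modes is forced by `(c₁ - c₂)
λ² x₂`. Two devices repair this. In `|A^{1/2}w|² - |A^{1/2}u|²` half a derivative is moved from `w -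
u` to `w + u`, so the map on coefficients is Lipschitz in norms weighted by `exp(κt)`, and is a
contraction for large `κ` (`IsLinearSolution.abs_coeff_sub_le`). In the full energy norm there is
only continuity without a rate, by dominated convergence over the modes
(`IsLinearSolution.exists_energy_sub_lt`).

The contraction is run in a small ball around the coefficient of the given solution. There the
linear solutions stay within energy distance 1 of `u`, so their bounds, and hence the Lipschitz
constant of the new coefficient, are known on all of `[0, T]`. This gives existence on the whole
interval at once, with no continuation argument (`IsSolution.exists_stability_radius`). -/

/-! ### Contraction in weighted norms and existence for a single mode. -/

/-- Banach iteration for the norm `sup |x t| exp(-κt)` on `[0, T]`. Values outside `[0, T]` are not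
controlled, so the limit and the fixed point equation concern `[0, T]` only. -/
theorem exists_fixedPoint_of_halving {T κ : ℝ} {K : Set (ℝ → ℝ)} {Φ : (ℝ → ℝ) → ℝ → ℝ}
    (hmaps : ∀ x ∈ K, Φ x ∈ K) {x₀ : ℝ → ℝ} (hx₀ : x₀ ∈ K)
    (hhalf : ∀ x ∈ K, ∀ y ∈ K, ∀ B : ℝ, 0 ≤ B →
      (∀ t ∈ Icc 0 T, |x t - y t| ≤ B * Real.exp (κ * t)) →
      ∀ t ∈ Icc 0 T, |Φ x t - Φ y t| ≤ B / 2 * Real.exp (κ * t))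
    (hbdd : ∃ B : ℝ, 0 ≤ B ∧ ∀ t ∈ Icc 0 T, |x₀ t - Φ x₀ t| ≤ B * Real.exp (κ * t))
    (hclosed : ∀ (x : ℕ → ℝ → ℝ) (y : ℝ → ℝ), (∀ n, x n ∈ K) →
      TendstoUniformlyOn x y atTop (Icc 0 T) → y ∈ K) :
    ∃ y ∈ K, ∀ t ∈ Icc 0 T, Φ y t = y t := by
  obtain ⟨B, hB0, hB⟩ := hbdd
  set x : ℕ → ℝ → ℝ := fun n => Φ^[n] x₀ with hx
  have hxs : ∀ n, x (n + 1) = Φ (x n) := fun n => Function.iterate_succ_apply' Φ n x₀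
  have hxK : ∀ n, x n ∈ K := by
    intro n
    induction n with
    | zero => exact hx₀
    | succ n ih => rw [hxs]; exact hmaps _ ih
  have hstep : ∀ n, ∀ t ∈ Icc 0 T, |x n t - x (n + 1) t| ≤ B / 2 ^ n * Real.exp (κ * t) := by
    intro n
    induction n with
    | zero => intro t ht; simpa [hx] using hB t ht
    | succ n ih =>
      intro t ht
      have := hhalf _ (hxK n) _ (hxK (n + 1)) (B / 2 ^ n) (by positivity) ih t ht
      rw [hxs (n + 1), hxs n] at *
      rw [pow_succ, ← div_div]
      exact this
  have hstep' : ∀ t ∈ Icc 0 T, ∀ n, dist (x n t) (x (n + 1) t)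
      ≤ (2 * (B * Real.exp (κ * t))) / 2 / 2 ^ n := by
    intro t ht n
    rw [Real.dist_eq]
    refine (hstep n t ht).trans (le_of_eq ?_)
    ring
  have hlim : ∀ t ∈ Icc 0 T, ∃ a, Tendsto (fun n => x n t) atTop (𝓝 a) := fun t ht =>
    cauchySeq_tendsto_of_complete (cauchySeq_of_le_geometric_two (hstep' t ht))
  choose! y hy using hlim
  have hxy : ∀ n, ∀ t ∈ Icc 0 T, |x n t - y t| ≤ 2 * B / 2 ^ n * Real.exp (κ * t) := by
    intro n t ht
    have := dist_le_of_le_geometric_two_of_tendsto (hstep' t ht) (hy t ht) n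
    rw [Real.dist_eq] at this
    refine this.trans (le_of_eq ?_)
    ring
  have hpow : Tendsto (fun n : ℕ => ((1 : ℝ) / 2) ^ n) atTop (𝓝 0) :=
    tendsto_pow_atTop_nhds_zero_of_lt_one (by norm_num) (by norm_num)
  have hyK : y ∈ K := by
    refine hclosed x y hxK ?_
    rw [Metric.tendstoUniformlyOn_iff]
    intro ε hε
    have h0 : Tendsto (fun n : ℕ => 2 * B * Real.exp (|κ| * |T|) * ((1 : ℝ) / 2) ^ n) atTop (𝓝 0) := by
      simpa using hpow.const_mul (2 * B * Real.exp (|κ| * |T|))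
    filter_upwards [h0.eventually_lt_const hε] with n hn t ht
    rw [dist_comm, Real.dist_eq]
    refine (hxy n t ht).trans_lt (lt_of_le_of_lt ?_ hn)
    have h1 : κ * t ≤ |κ| * |T| := by
      refine (le_abs_self _).trans ?_
      rw [abs_mul]
      refine mul_le_mul_of_nonneg_left ?_ (abs_nonneg _)
      rw [abs_of_nonneg ht.1]
      exact ht.2.trans (le_abs_self _)
    have h2 := Real.exp_le_exp.2 h1
    calc 2 * B / 2 ^ n * Real.exp (κ * t) ≤ 2 * B / 2 ^ n * Real.exp (|κ| * |T|) := by gcongr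
      _ = _ := by rw [div_pow, one_pow]; ring
  refine ⟨y, hyK, fun t ht => ?_⟩
  have h1 : Tendsto (fun n => x (n + 1) t) atTop (𝓝 (Φ y t)) := by
    rw [tendsto_iff_dist_tendsto_zero]
    have h0 : Tendsto (fun n : ℕ => B * Real.exp (κ * t) * ((1 : ℝ) / 2) ^ n) atTop (𝓝 0) := by
      simpa using hpow.const_mul (B * Real.exp (κ * t))
    refine squeeze_zero (fun _ => dist_nonneg) (fun n => ?_) h0
    rw [hxs, Real.dist_eq]
    refine (hhalf _ (hxK n) _ hyK _ (by positivity) (hxy n) t ht).trans (le_of_eq ?_)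
    rw [div_pow, one_pow]; ring
  exact tendsto_nhds_unique h1 ((hy t ht).comp (tendsto_add_atTop_nat 1))

/-- Each integration gains a factor `1/κ` in the weighted norm; this makes the Picard map below a
contraction on an interval of any length. -/
theorem abs_le_exp_of_abs_deriv_le {T κ C : ℝ} (hκ : 0 < κ) (hC : 0 ≤ C) {f f' : ℝ → ℝ}
    (h0 : f 0 = 0) (hf : ∀ t, HasDerivAt f (f' t) t)
    (hf' : ∀ t ∈ Icc 0 T, |f' t| ≤ C * Real.exp (κ * t)) :
    ∀ t ∈ Icc 0 T, |f t| ≤ C / κ * Real.exp (κ * t) := by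
  intro t ht
  have hB : ∀ x, HasDerivAt (fun s => C / κ * Real.exp (κ * s)) (C * Real.exp (κ * x)) x := by
    intro x
    have := ((((hasDerivAt_id x).const_mul κ).exp).const_mul (C / κ))
    refine this.congr_deriv ?_
    simp only [id]
    field_simp
  exact image_norm_le_of_norm_deriv_right_le_deriv_boundary
    (f := f) (f' := f') (a := 0) (b := T)
    (fun x _ => (hf x).continuousAt.continuousWithinAt)
    (fun x _ => (hf x).hasDerivWithinAt)
    (by rw [h0, norm_zero]; positivity) hB
    (fun x hx => hf' x (Ico_subset_Icc_self hx)) ht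

/-- Two integrations turn the factor `lam² M` into `lam² M / κ²`, which is at most `1/2` for the
chosen `κ`. The rate may depend on `lam`, because estimates uniform in `lam` come later from the
energy. -/
theorem exists_mode_solution {T M lam : ℝ} (hT : 0 < T) {c : ℝ → ℝ}
    (hc : ContinuousOn c (Icc 0 T)) (hcM : ∀ t ∈ Icc 0 T, |c t| ≤ M) (a b : ℝ) :
    ∃ x y : ℝ → ℝ, x 0 = a ∧ y 0 = b ∧
      (∀ t ∈ Icc 0 T, HasDerivWithinAt x (y t) (Icc 0 T) t) ∧
      ∀ t ∈ Icc 0 T, HasDerivWithinAt y (-(c t * (lam ^ 2 * x t))) (Icc 0 T) t := by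
  have hM : 0 ≤ M := (abs_nonneg _).trans (hcM 0 ⟨le_rfl, hT.le⟩)
  -- Projection onto `[0, T]`: composing with it makes the integrands continuous on the whole line.
  set p : ℝ → ℝ := fun t => max 0 (min t T) with hp
  have hpc : Continuous p := by fun_prop
  have hpm : ∀ t, p t ∈ Icc 0 T := fun t =>
    ⟨le_max_left _ _, max_le hT.le (min_le_right _ _)⟩
  have hpe : ∀ t ∈ Icc 0 T, p t = t := fun t ht => by
    simp only [hp, min_eq_left ht.2, max_eq_right ht.1]
  set F : (ℝ → ℝ) → ℝ → ℝ := fun x r => -(c (p r) * (lam ^ 2 * x (p r))) with hF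
  set Y : (ℝ → ℝ) → ℝ → ℝ := fun x s => b + ∫ r in (0 : ℝ)..s, F x r with hY
  set Φ : (ℝ → ℝ) → ℝ → ℝ := fun x t => a + ∫ s in (0 : ℝ)..t, Y x s with hΦ
  have hFc : ∀ x, ContinuousOn x (Icc 0 T) → Continuous (F x) := by
    intro x hx
    have h1 : Continuous (fun r => c (p r)) := hc.comp_continuous hpc hpm
    have h2 : Continuous (fun r => x (p r)) := hx.comp_continuous hpc hpm
    exact (h1.mul (continuous_const.mul h2)).neg
  have hYd : ∀ x, ContinuousOn x (Icc 0 T) → ∀ t, HasDerivAt (Y x) (F x t) t := by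
    intro x hx t
    exact ((hFc x hx).integral_hasStrictDerivAt 0 t).hasDerivAt.const_add b
  have hΦd : ∀ x, ContinuousOn x (Icc 0 T) → ∀ t, HasDerivAt (Φ x) (Y x t) t := by
    intro x hx t
    have : Continuous (Y x) := continuous_iff_continuousAt.2 fun t => (hYd x hx t).continuousAt
    exact (this.integral_hasStrictDerivAt 0 t).hasDerivAt.const_add a
  set κ : ℝ := 1 + 2 * (lam ^ 2 * M) with hκ
  have hκ1 : 1 ≤ κ := by rw [hκ]; nlinarith [mul_nonneg (sq_nonneg lam) hM]
  have hκ0 : 0 < κ := by linarith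
  have hΦc : ∀ x, ContinuousOn x (Icc 0 T) → ContinuousOn (Φ x) (Icc 0 T) := fun x hx t _ =>
    (hΦd x hx t).continuousAt.continuousWithinAt
  obtain ⟨x, hx, hfix⟩ := exists_fixedPoint_of_halving (T := T) (κ := κ)
    (K := {x | ContinuousOn x (Icc 0 T)}) (Φ := Φ) hΦc (x₀ := fun _ => 0) continuousOn_const
    (by
      intro x hx y hy B hB hxy
      have h2 : ∀ t ∈ Icc 0 T, |Y x t - Y y t| ≤ (lam ^ 2 * M * B) / κ * Real.exp (κ * t) := by
        refine abs_le_exp_of_abs_deriv_le (f := fun t => Y x t - Y y t)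
          (f' := fun t => F x t - F y t) hκ0 (by positivity) (by simp [hY])
          (fun t => (hYd x hx t).sub (hYd y hy t)) (fun t ht => ?_)
        have : F x t - F y t = -(c t * (lam ^ 2 * (x t - y t))) := by
          simp only [hF, hpe t ht]; ring
        rw [this, abs_neg, abs_mul, abs_mul, abs_of_nonneg (sq_nonneg lam)]
        calc |c t| * (lam ^ 2 * |x t - y t|)
            ≤ M * (lam ^ 2 * (B * Real.exp (κ * t))) := by
              gcongr
              · exact hcM t ht
              · exact hxy t ht
          _ = _ := by ring
      have h3 : ∀ t ∈ Icc 0 T, |Φ x t - Φ y t|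
          ≤ (lam ^ 2 * M * B) / κ / κ * Real.exp (κ * t) := by
        exact abs_le_exp_of_abs_deriv_le (f := fun t => Φ x t - Φ y t)
          (f' := fun t => Y x t - Y y t) hκ0 (by positivity) (by simp [hΦ])
          (fun t => (hΦd x hx t).sub (hΦd y hy t)) h2
      intro t ht
      refine (h3 t ht).trans (mul_le_mul_of_nonneg_right ?_ (Real.exp_nonneg _))
      rw [div_div, div_le_div_iff₀ (by positivity) (by norm_num)]
      have h4 : 2 * (lam ^ 2 * M) ≤ κ * κ := by nlinarith
      nlinarith)
    (by
      obtain ⟨B, hB⟩ := isCompact_Icc.exists_bound_of_continuousOn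
        (hΦc (fun _ => 0) continuousOn_const)
      refine ⟨B, (norm_nonneg _).trans (hB 0 ⟨le_rfl, hT.le⟩), fun t ht => ?_⟩
      have h1 := hB t ht
      have h2 : 1 ≤ Real.exp (κ * t) := Real.one_le_exp (mul_nonneg hκ0.le ht.1)
      rw [Real.norm_eq_abs] at h1
      rw [zero_sub, abs_neg]
      nlinarith [abs_nonneg (Φ (fun _ => 0) t)])
    (fun x y hx hxy => hxy.continuousOn (Frequently.of_forall hx))
  have hx' : ContinuousOn x (Icc 0 T) := hx
  -- The fixed point `x` is known to agree with `Φ x` only on `[0, T]`, so `Φ x`, which is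
  -- differentiable everywhere, is the solution returned.
  refine ⟨Φ x, Y x, by simp [hΦ], by simp [hY], fun t _ => (hΦd x hx t).hasDerivWithinAt,
    fun t ht => ?_⟩
  refine (hYd x hx t).hasDerivWithinAt.congr_deriv ?_
  simp only [hF, hpe t ht, hfix t ht]

/-! ### Energy estimates for a single mode, uniform in the frequency. -/

/-- Energy bound for `x'' + c lam² x = g` when `c` is `L`-Lipschitz and `g` grows at most
exponentially. -/
theorem forced_mode_energy_le {T L ν κ γ lam : ℝ} (hν : 0 < ν) (hκ : 0 < κ)
    (hLκ : 2 * L ≤ κ * ν) {c x y g : ℝ → ℝ}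
    (hcν : ∀ t ∈ Icc 0 T, ν ≤ c t)
    (hcL : ∀ s ∈ Icc 0 T, ∀ t ∈ Icc 0 T, |c t - c s| ≤ L * |t - s|)
    (hx : ∀ t ∈ Icc 0 T, HasDerivWithinAt x (y t) (Icc 0 T) t)
    (hy : ∀ t ∈ Icc 0 T, HasDerivWithinAt y (-(c t * (lam ^ 2 * x t)) + g t) (Icc 0 T) t)
    (hg : ∀ t ∈ Icc 0 T, |g t| ≤ γ * Real.exp (κ * t)) :
    ∀ t ∈ Icc 0 T, y t ^ 2 + c t * (lam ^ 2 * x t ^ 2)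
      ≤ (y 0 ^ 2 + c 0 * (lam ^ 2 * x 0 ^ 2) + 2 * γ ^ 2 / κ ^ 2) * Real.exp (2 * κ * t) := by
  intro t ht
  have hT : 0 ≤ T := ht.1.trans ht.2
  have hcc : ContinuousOn c (Icc 0 T) := by
    have hL' : LipschitzOnWith (Real.toNNReal L) c (Icc 0 T) :=
      LipschitzOnWith.of_dist_le_mul fun a ha b hb => by
        rw [Real.dist_eq, Real.dist_eq]
        refine (hcL b hb a ha).trans ?_
        gcongr
        exact Real.le_coe_toNNReal L
    exact hL'.continuousOn
  have hxc : ContinuousOn x (Icc 0 T) := fun s hs => (hx s hs).continuousWithinAt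
  have hyc : ContinuousOn y (Icc 0 T) := fun s hs => (hy s hs).continuousWithinAt
  set E : ℝ → ℝ := fun t => y t ^ 2 + c t * (lam ^ 2 * x t ^ 2) with hE
  have hEc : ContinuousOn E (Icc 0 T) := by fun_prop
  have h0 : (0 : ℝ) ∈ Icc 0 T := ⟨le_rfl, hT⟩
  have hE0 : ∀ t ∈ Icc 0 T, ν * (lam ^ 2 * x t ^ 2) ≤ E t - y t ^ 2 := by
    intro t ht
    have : ν * (lam ^ 2 * x t ^ 2) ≤ c t * (lam ^ 2 * x t ^ 2) :=
      mul_le_mul_of_nonneg_right (hcν t ht) (by positivity)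
    simp only [hE]; linarith
  -- The margin `ε` gives the strict inequality that the comparison lemma requires at contact
  -- points.
  have key : ∀ ε > 0, E t ≤ (E 0 + 2 * γ ^ 2 / κ ^ 2 + ε) * Real.exp (2 * κ * t) := by
    intro ε hε
    set D := E 0 + 2 * γ ^ 2 / κ ^ 2 + ε with hD
    have hB : ∀ s, HasDerivAt (fun s => D * Real.exp (2 * κ * s))
        (2 * κ * (D * Real.exp (2 * κ * s))) s := by
      intro s
      refine (((hasDerivAt_id s).const_mul (2 * κ)).exp.const_mul D).congr_deriv ?_
      simp only [id]; ring
    refine image_le_of_liminf_slope_right_lt_deriv_boundary (f := E)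
      (f' := fun s => 2 * y s * g s + L * (lam ^ 2 * x s ^ 2)) hEc ?_
      (B := fun s => D * Real.exp (2 * κ * s)) ?_ hB ?_ ht
    · intro s hs r hr
      have hs' := Ico_subset_Icc_self hs
      have hxr : HasDerivWithinAt x (y s) (Ioi s) s :=
        ((hx s hs').mono_of_mem_nhdsWithin (Icc_mem_nhdsGT_of_mem hs))
      have hyr : HasDerivWithinAt y (-(c s * (lam ^ 2 * x s)) + g s) (Ioi s) s :=
        ((hy s hs').mono_of_mem_nhdsWithin (Icc_mem_nhdsGT_of_mem hs))
      have hid : HasDerivWithinAt (fun z : ℝ => z - s) 1 (Ioi s) s :=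
        ((hasDerivAt_id s).sub_const s).hasDerivWithinAt
      -- Since `c` need not be differentiable, `c z` is replaced by `c s + L (z - s)`. The resulting
      -- differentiable function of `z` dominates `E` to the right of `s` and equals it at `s`; the
      -- terms containing `c s` cancel in its derivative.
      have hh := ((hyr.pow 2).add (((hxr.pow 2).const_mul (c s * lam ^ 2)))).add
        ((hid.const_mul L).mul ((hxr.pow 2).const_mul (lam ^ 2)))
      have hh' := (hasDerivWithinAt_iff_tendsto_slope' (lt_irrefl s)).1 hh
      have hev : ∀ᶠ z in 𝓝[>] s, slope E s z < r := by
        have h1 := hh'.eventually_lt_const (u := r) (by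
          refine lt_of_eq_of_lt ?_ hr
          simp
          ring)
        filter_upwards [h1, Icc_mem_nhdsGT_of_mem hs, self_mem_nhdsWithin] with z hz hzI hzs
        refine lt_of_le_of_lt ?_ hz
        have hzs' : s < z := hzs
        rw [slope_def_field, slope_def_field]
        refine div_le_div_of_nonneg_right ?_ (by linarith)
        have h2 := (abs_le.1 (hcL s hs' z hzI)).2
        rw [abs_of_pos (by linarith)] at h2
        have h3 := mul_le_mul_of_nonneg_right h2 (by positivity : 0 ≤ lam ^ 2 * x z ^ 2)
        simp [hE]
        linarith
      exact hev.frequently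
    · simp only [hD, mul_zero, Real.exp_zero, mul_one]
      have : 0 ≤ 2 * γ ^ 2 / κ ^ 2 := by positivity
      linarith
    · intro s hs hEs
      have hs' := Ico_subset_Icc_self hs
      have h1 := hE0 s hs'
      have h2 := hg s hs'
      have h3 : Real.exp (2 * κ * s) = Real.exp (κ * s) ^ 2 := by
        rw [← Real.exp_nat_mul]; congr 1; push_cast; ring
      have h4 : 2 * y s * g s ≤ κ * y s ^ 2 + (γ * Real.exp (κ * s)) ^ 2 / κ := by
        have h5 : g s ^ 2 ≤ (γ * Real.exp (κ * s)) ^ 2 := sq_le_sq' (by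
          linarith [(abs_le.1 h2).1]) (abs_le.1 h2).2
        have h6 : 2 * y s * g s ≤ κ * y s ^ 2 + g s ^ 2 / κ := by
          have : 0 ≤ (κ * y s - g s) ^ 2 / κ := by positivity
          have h7 : (κ * y s - g s) ^ 2 / κ = κ * y s ^ 2 + g s ^ 2 / κ - 2 * y s * g s := by
            field_simp; ring
          linarith
        have : g s ^ 2 / κ ≤ (γ * Real.exp (κ * s)) ^ 2 / κ :=
          div_le_div_of_nonneg_right h5 hκ.le
        linarith
      set X := Real.exp (κ * s) ^ 2 with hX
      have hXpos : 0 < X := by positivity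
      -- The variation of `c` costs at most `κ/2` times the potential part of the energy; this is
      -- where `2 L ≤ κ ν` enters.
      have h5 : L * (lam ^ 2 * x s ^ 2) ≤ κ / 2 * (E s - y s ^ 2) := by
        have : L * (lam ^ 2 * x s ^ 2) ≤ κ * ν / 2 * (lam ^ 2 * x s ^ 2) :=
          mul_le_mul_of_nonneg_right (by linarith) (by positivity)
        nlinarith
      have h6 : (γ * Real.exp (κ * s)) ^ 2 / κ = κ / 2 * (2 * γ ^ 2 / κ ^ 2 * X) := by
        rw [mul_pow, ← hX]; field_simp
      have hE00 : 0 ≤ E 0 := by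
        have := hE0 0 h0
        have h8 : 0 ≤ ν * (lam ^ 2 * x 0 ^ 2) := by positivity
        nlinarith [sq_nonneg (y 0)]
      have h7 : E s = D * X := by rw [hEs, h3]
      have h9 : 2 * γ ^ 2 / κ ^ 2 * X < D * X := by
        apply mul_lt_mul_of_pos_right _ hXpos
        linarith
      have h10 : κ / 2 * (2 * γ ^ 2 / κ ^ 2 * X) < κ / 2 * (D * X) :=
        mul_lt_mul_of_pos_left h9 (by linarith)
      have h11 : y s ^ 2 ≤ E s := by
        have h8 : 0 ≤ ν * (lam ^ 2 * x s ^ 2) := by positivity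
        linarith
      have h12 : κ * y s ^ 2 ≤ κ * E s := mul_le_mul_of_nonneg_left h11 hκ.le
      change 2 * y s * g s + L * (lam ^ 2 * x s ^ 2) < 2 * κ * (D * Real.exp (2 * κ * s))
      rw [h3, ← h7]
      rw [← h7, ← h6] at h10
      have h13 : 0 ≤ κ * y s ^ 2 := by positivity
      linarith
  refine le_of_forall_pos_le_add fun ε hε => ?_
  have := key (ε / Real.exp (2 * κ * t)) (by positivity)
  refine this.trans (le_of_eq ?_)
  rw [add_mul, div_mul_cancel₀ _ (Real.exp_ne_zero _)]

/-- The pair `(x, y)` is a solution of `x' = y`, `y' = -c lam² x` on `[0, T]`. -/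
def IsMode (T : ℝ) (c : ℝ → ℝ) (lam : ℝ) (x y : ℝ → ℝ) : Prop :=
  (∀ t ∈ Icc 0 T, HasDerivWithinAt x (y t) (Icc 0 T) t) ∧
    ∀ t ∈ Icc 0 T, HasDerivWithinAt y (-(c t * (lam ^ 2 * x t))) (Icc 0 T) t

/-- Coefficients on `[0, T]` with values in `[ν, M]` and Lipschitz constant `L`. -/
structure IsCoeff (T ν M L : ℝ) (c : ℝ → ℝ) : Prop where
  lower : ∀ t ∈ Icc 0 T, ν ≤ c t
  upper : ∀ t ∈ Icc 0 T, c t ≤ M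
  lip : ∀ s ∈ Icc 0 T, ∀ t ∈ Icc 0 T, |c t - c s| ≤ L * |t - s|

/-- The growth factor of the energy of a mode over `[0, T]`. -/
noncomputable def growth (T ν M L : ℝ) : ℝ :=
  M / ν * Real.exp (2 * (2 * L / ν + 1) * T)

theorem growth_nonneg {T ν M L : ℝ} (hν : 0 < ν) (hM : 1 ≤ M) : 0 ≤ growth T ν M L := by
  unfold growth; positivity

/-- The unforced case. The constant does not depend on `lam`, so the bound can be summed over the
modes with any weight. The `+ 1` in the rate keeps it positive when `L = 0`. -/
theorem IsMode.energy_le {T L ν M lam : ℝ} (hν : 0 < ν) (hν1 : ν ≤ 1) (hM : 1 ≤ M) (hL : 0 ≤ L)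
    {c x y : ℝ → ℝ} (hc : IsCoeff T ν M L c) (h : IsMode T c lam x y) :
    ∀ t ∈ Icc 0 T, y t ^ 2 + lam ^ 2 * x t ^ 2
      ≤ growth T ν M L * (y 0 ^ 2 + lam ^ 2 * x 0 ^ 2) := by
  intro t ht
  have h0 : (0 : ℝ) ∈ Icc 0 T := ⟨le_rfl, ht.1.trans ht.2⟩
  have hκ : 0 < 2 * L / ν + 1 := by positivity
  have h1 := forced_mode_energy_le (T := T) (L := L) (ν := ν) (κ := 2 * L / ν + 1) (γ := 0)
    (lam := lam) (g := fun _ => 0) hν hκ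
    (by rw [add_mul, div_mul_cancel₀ _ hν.ne']; linarith) hc.lower hc.lip h.1
    (by simpa using h.2) (by simp) t ht
  have h2 : ν * (y t ^ 2 + lam ^ 2 * x t ^ 2) ≤ y t ^ 2 + c t * (lam ^ 2 * x t ^ 2) := by
    have := mul_le_mul_of_nonneg_right (hc.lower t ht) (by positivity : 0 ≤ lam ^ 2 * x t ^ 2)
    nlinarith [sq_nonneg (y t)]
  have h3 : y 0 ^ 2 + c 0 * (lam ^ 2 * x 0 ^ 2) ≤ M * (y 0 ^ 2 + lam ^ 2 * x 0 ^ 2) := by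
    have := mul_le_mul_of_nonneg_right (hc.upper 0 h0) (by positivity : 0 ≤ lam ^ 2 * x 0 ^ 2)
    nlinarith [sq_nonneg (y 0)]
  have h4 : Real.exp (2 * (2 * L / ν + 1) * t) ≤ Real.exp (2 * (2 * L / ν + 1) * T) := by
    gcongr; exact ht.2
  have h5 : ν * (y t ^ 2 + lam ^ 2 * x t ^ 2)
      ≤ M * (y 0 ^ 2 + lam ^ 2 * x 0 ^ 2) * Real.exp (2 * (2 * L / ν + 1) * T) := by
    refine h2.trans (h1.trans ?_)
    have : y 0 ^ 2 + c 0 * (lam ^ 2 * x 0 ^ 2) + 2 * 0 ^ 2 / (2 * L / ν + 1) ^ 2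
        ≤ M * (y 0 ^ 2 + lam ^ 2 * x 0 ^ 2) := by simpa using h3
    gcongr
  rw [mul_comm ν, ← le_div_iff₀ hν] at h5
  refine h5.trans (le_of_eq ?_)
  rw [growth]
  ring

/-- Dependence of a mode on the initial data and on the coefficient. -/
theorem IsMode.sub_energy_le {T L ν M lam κ B : ℝ} (hν : 0 < ν) (hν1 : ν ≤ 1) (hM : 1 ≤ M)
    (hL : 0 ≤ L) (hlam : 0 ≤ lam) (hκ : 2 * L / ν + 1 ≤ κ) (hB : 0 ≤ B)
    {c₁ c₂ x₁ y₁ x₂ y₂ : ℝ → ℝ}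
    (hc₁ : IsCoeff T ν M L c₁) (hc₂ : IsCoeff T ν M L c₂)
    (h₁ : IsMode T c₁ lam x₁ y₁) (h₂ : IsMode T c₂ lam x₂ y₂)
    (hcc : ∀ t ∈ Icc 0 T, |c₁ t - c₂ t| ≤ B * Real.exp (κ * t)) :
    ∀ t ∈ Icc 0 T, (y₁ t - y₂ t) ^ 2 + lam ^ 2 * (x₁ t - x₂ t) ^ 2
      ≤ 2 * growth T ν M L / ν * Real.exp (2 * κ * t) *
        ((y₁ 0 - y₂ 0) ^ 2 + lam ^ 2 * (x₁ 0 - x₂ 0) ^ 2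
          + B ^ 2 / κ ^ 2 * (lam ^ 2 * (y₂ 0 ^ 2 + lam ^ 2 * x₂ 0 ^ 2))) := by
  intro t ht
  have hT : 0 ≤ T := ht.1.trans ht.2
  have h0 : (0 : ℝ) ∈ Icc 0 T := ⟨le_rfl, hT⟩
  have hLν : 0 ≤ 2 * L / ν := by positivity
  have hκ0 : 0 < κ := by linarith
  set C := growth T ν M L with hC
  have hMC : M ≤ C := by
    have e1 : M ≤ M / ν := by
      rw [le_div_iff₀ hν]; nlinarith
    have e2 : 1 ≤ Real.exp (2 * (2 * L / ν + 1) * T) := Real.one_le_exp (by positivity)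
    calc M ≤ M / ν := e1
      _ = M / ν * 1 := (mul_one _).symm
      _ ≤ _ := mul_le_mul_of_nonneg_left e2 (by positivity)
  set Q := y₂ 0 ^ 2 + lam ^ 2 * x₂ 0 ^ 2 with hQ
  have hQ0 : 0 ≤ Q := by positivity
  have hC0 : 0 ≤ C := by linarith
  -- The forcing is `(c₁ - c₂) lam (lam x₂)`. The energy of the second mode controls `lam x₂`; the
  -- remaining `lam` is the lost derivative, seen as the extra `lam²` in the conclusion.
  have hbound : ∀ s ∈ Icc 0 T, |lam * x₂ s| ≤ Real.sqrt (C * Q) := by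
    intro s hs
    apply Real.abs_le_sqrt
    have := h₂.energy_le hν hν1 hM hL hc₂ s hs
    nlinarith [sq_nonneg (y₂ s)]
  have h1 := forced_mode_energy_le (T := T) (L := L) (ν := ν) (κ := κ)
    (γ := B * (lam * Real.sqrt (C * Q)))
    (lam := lam) (c := c₁) (x := fun t => x₁ t - x₂ t) (y := fun t => y₁ t - y₂ t)
    (g := fun t => -((c₁ t - c₂ t) * (lam ^ 2 * x₂ t))) hν hκ0
    (by
      have : 2 * L = 2 * L / ν * ν := by field_simp
      nlinarith) hc₁.lower hc₁.lip
    (fun s hs => (h₁.1 s hs).sub (h₂.1 s hs))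
    (fun s hs => ((h₁.2 s hs).sub (h₂.2 s hs)).congr_deriv (by ring))
    (fun s hs => by
      rw [abs_neg, abs_mul, pow_two, mul_assoc, abs_mul, abs_of_nonneg hlam]
      calc |c₁ s - c₂ s| * (lam * |lam * x₂ s|)
          ≤ (B * Real.exp (κ * s)) * (lam * Real.sqrt (C * Q)) := by
            gcongr
            · exact hcc s hs
            · exact hbound s hs
        _ = _ := by ring) t ht
  set Z := (y₁ 0 - y₂ 0) ^ 2 + lam ^ 2 * (x₁ 0 - x₂ 0) ^ 2 with hZ
  have hZ0 : 0 ≤ Z := by positivity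
  have h2 : ν * ((y₁ t - y₂ t) ^ 2 + lam ^ 2 * (x₁ t - x₂ t) ^ 2)
      ≤ (y₁ t - y₂ t) ^ 2 + c₁ t * (lam ^ 2 * (x₁ t - x₂ t) ^ 2) := by
    have := mul_le_mul_of_nonneg_right (hc₁.lower t ht)
      (by positivity : 0 ≤ lam ^ 2 * (x₁ t - x₂ t) ^ 2)
    nlinarith [sq_nonneg (y₁ t - y₂ t)]
  have h3 : (y₁ 0 - y₂ 0) ^ 2 + c₁ 0 * (lam ^ 2 * (x₁ 0 - x₂ 0) ^ 2) ≤ 2 * C * Z := by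
    have := mul_le_mul_of_nonneg_right (hc₁.upper 0 h0)
      (by positivity : 0 ≤ lam ^ 2 * (x₁ 0 - x₂ 0) ^ 2)
    have h4 : M * Z ≤ 2 * C * Z := mul_le_mul_of_nonneg_right (by linarith) hZ0
    nlinarith [sq_nonneg (y₁ 0 - y₂ 0)]
  have h4 : 2 * (B * (lam * Real.sqrt (C * Q))) ^ 2 / κ ^ 2
      = 2 * C * (B ^ 2 / κ ^ 2 * (lam ^ 2 * Q)) := by
    rw [mul_pow, mul_pow, Real.sq_sqrt (by positivity)]
    ring
  rw [h4] at h1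
  have h5 : ν * ((y₁ t - y₂ t) ^ 2 + lam ^ 2 * (x₁ t - x₂ t) ^ 2)
      ≤ 2 * C * (Z + B ^ 2 / κ ^ 2 * (lam ^ 2 * Q)) * Real.exp (2 * κ * t) := by
    refine h2.trans (h1.trans ?_)
    gcongr
    linarith
  rw [mul_comm ν, ← le_div_iff₀ hν] at h5
  refine h5.trans (le_of_eq ?_)
  ring

/-! ### Convergence, continuity and derivatives in `H` from coordinates. -/

section Coordinates

variable {H ι : Type*} [NormedAddCommGroup H] [InnerProductSpace ℝ H]

theorem hasSum_inner_sq (e : HilbertBasis ι ℝ H) (z : H) :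
    HasSum (fun k => inner ℝ (e k) z ^ 2) (‖z‖ ^ 2) := by
  have h := e.hasSum_inner_mul_inner z z
  rw [real_inner_self_eq_norm_sq] at h
  refine h.congr_fun fun k => ?_
  rw [real_inner_comm z (e k), pow_two]

theorem eq_of_inner_eq (e : HilbertBasis ι ℝ H) {x y : H}
    (h : ∀ k, inner ℝ (e k) x = inner ℝ (e k) y) : x = y := by
  have h1 := hasSum_inner_sq e (x - y)
  have h2 : (fun k => inner ℝ (e k) (x - y) ^ 2) = fun _ => 0 := by
    funext k; rw [inner_sub_right, h k]; simp
  rw [h2] at h1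
  have h3 := h1.unique hasSum_zero
  exact sub_eq_zero.1 (norm_eq_zero.1 (pow_eq_zero_iff (two_ne_zero) |>.1 h3))

theorem hasSum_of_summable_sq (e : HilbertBasis ι ℝ H) {f : ι → ℝ}
    (hf : Summable fun k => f k ^ 2) :
    ∃ z : H, HasSum (fun k => f k • e k) z ∧ ∀ k, inner ℝ (e k) z = f k := by
  have hmem : Memℓp f 2 := by
    refine memℓp_gen ?_
    simpa using hf
  refine ⟨e.repr.symm ⟨f, hmem⟩, e.hasSum_repr_symm ⟨f, hmem⟩, fun k => ?_⟩
  rw [← e.repr_apply_apply, LinearIsometryEquiv.apply_symm_apply]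

/-- Dominated convergence in Parseval's identity. A summable majorant of the squared coordinates
upgrades coordinatewise convergence to norm convergence, since `(a - b)² ≤ 2a² + 2b² ≤ 4S`. -/
theorem tendsto_of_tendsto_inner (e : HilbertBasis ι ℝ H) {X : Type*} {l : Filter X} {F : X → H}
    {z : H} {S : ι → ℝ} (hS : Summable S)
    (hF : ∀ᶠ x in l, ∀ k, inner ℝ (e k) (F x) ^ 2 ≤ S k) (hz : ∀ k, inner ℝ (e k) z ^ 2 ≤ S k)
    (h : ∀ k, Tendsto (fun x => inner ℝ (e k) (F x)) l (𝓝 (inner ℝ (e k) z))) :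
    Tendsto F l (𝓝 z) := by
  rw [tendsto_iff_norm_sub_tendsto_zero]
  have h1 : Tendsto (fun x => ∑' k, inner ℝ (e k) (F x - z) ^ 2) l (𝓝 (∑' _ : ι, (0 : ℝ))) := by
    refine tendsto_tsum_of_dominated_convergence (hS.mul_left 4) (fun k => ?_) ?_
    · have := ((h k).sub_const (inner ℝ (e k) z)).pow 2
      simpa [inner_sub_right] using this
    · filter_upwards [hF] with x hx k
      rw [Real.norm_eq_abs, abs_of_nonneg (sq_nonneg _), inner_sub_right]
      nlinarith [hx k, hz k, sq_nonneg (inner ℝ (e k) (F x) + inner ℝ (e k) z)]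
  have h2 : (fun x => ∑' k, inner ℝ (e k) (F x - z) ^ 2) = fun x => ‖F x - z‖ ^ 2 := by
    funext x; exact (hasSum_inner_sq e _).tsum_eq
  rw [h2, tsum_zero] at h1
  have h3 := h1.sqrt
  simpa [Real.sqrt_sq] using h3

theorem continuousOn_of_inner (e : HilbertBasis ι ℝ H) {I : Set ℝ} {F : ℝ → H}
    {S : ι → ℝ} (hS : Summable S) (hF : ∀ t ∈ I, ∀ k, inner ℝ (e k) (F t) ^ 2 ≤ S k)
    (h : ∀ k, ContinuousOn (fun t => inner ℝ (e k) (F t)) I) : ContinuousOn F I := fun t ht =>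
  tendsto_of_tendsto_inner e hS (eventually_nhdsWithin_of_forall hF) (hF t ht)
    fun k => h k t ht

theorem abs_slope_le {T C : ℝ} {f g : ℝ → ℝ}
    (hf : ∀ t ∈ Icc 0 T, HasDerivWithinAt f (g t) (Icc 0 T) t)
    (hg : ∀ t ∈ Icc 0 T, |g t| ≤ C) {s t : ℝ} (hs : s ∈ Icc 0 T) (ht : t ∈ Icc 0 T)
    (hst : t ≠ s) : |slope f s t| ≤ C := by
  have h := (convex_Icc (0 : ℝ) T).norm_image_sub_le_of_norm_hasDerivWithin_le hf hg hs ht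
  rw [Real.norm_eq_abs, Real.norm_eq_abs] at h
  rw [slope_def_field, abs_div, div_le_iff₀ (abs_pos.2 (sub_ne_zero.2 hst))]
  exact h

/-- By the mean value inequality a majorant for the coordinates of the derivative also bounds those
of the difference quotients, so the convergence criterion applies to slopes. -/
theorem hasDerivWithinAt_of_inner (e : HilbertBasis ι ℝ H) {T : ℝ} {f g : ℝ → H}
    {S : ι → ℝ} (hS : Summable S) (hg : ∀ t ∈ Icc 0 T, ∀ k, inner ℝ (e k) (g t) ^ 2 ≤ S k)
    (h : ∀ k, ∀ t ∈ Icc 0 T, HasDerivWithinAt (fun s => inner ℝ (e k) (f s))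
      (inner ℝ (e k) (g t)) (Icc 0 T) t) :
    ∀ t ∈ Icc 0 T, HasDerivWithinAt f (g t) (Icc 0 T) t := by
  intro t ht
  rw [hasDerivWithinAt_iff_tendsto_slope]
  have hsl : ∀ k s, inner ℝ (e k) (slope f t s) = slope (fun s => inner ℝ (e k) (f s)) t s := by
    intro k s
    simp only [slope, vsub_eq_sub, inner_smul_right, inner_sub_right, smul_eq_mul]
  refine tendsto_of_tendsto_inner e hS ?_ (hg t ht) (fun k => ?_)
  · refine eventually_nhdsWithin_of_forall fun s hs k => ?_
    rw [hsl]
    have hb : ∀ t ∈ Icc 0 T, |inner ℝ (e k) (g t)| ≤ √(S k) := fun t ht =>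
      Real.abs_le_sqrt (hg t ht k)
    have := abs_slope_le (h k) hb ht hs.1 hs.2
    rw [← sq_abs]
    calc _ ≤ √(S k) ^ 2 := by gcongr
      _ = S k := Real.sq_sqrt ((sq_nonneg _).trans (hg t ht k))
  · simp only [hsl]
    exact hasDerivWithinAt_iff_tendsto_slope.1 (h k t ht)

theorem hasDerivWithinAt_tsum_of_bound {T : ℝ} {f g : ι → ℝ → ℝ} {b : ι → ℝ} (hb : Summable b)
    (hg : ∀ t ∈ Icc 0 T, ∀ k, |g k t| ≤ b k)
    (hf : ∀ t ∈ Icc 0 T, Summable fun k => f k t)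
    (h : ∀ k, ∀ t ∈ Icc 0 T, HasDerivWithinAt (f k) (g k t) (Icc 0 T) t) :
    ∀ t ∈ Icc 0 T, HasDerivWithinAt (fun s => ∑' k, f k s) (∑' k, g k t) (Icc 0 T) t := by
  intro t ht
  rw [hasDerivWithinAt_iff_tendsto_slope]
  have h1 : Tendsto (fun s => ∑' k, slope (f k) t s) (𝓝[Icc 0 T \ {t}] t) (𝓝 (∑' k, g k t)) := by
    refine tendsto_tsum_of_dominated_convergence hb
      (fun k => hasDerivWithinAt_iff_tendsto_slope.1 (h k t ht)) ?_
    refine eventually_nhdsWithin_of_forall fun s hs k => ?_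
    exact abs_slope_le (h k) (fun t ht => hg t ht k) ht hs.1 hs.2
  refine h1.congr' ?_
  refine eventually_nhdsWithin_of_forall fun s hs => ?_
  simp only [slope_def_field]
  rw [tsum_div_const, ((hf s hs.1).tsum_sub (hf t ht))]

end Coordinates

/-! ### Powers of `A` and the energy as weighted sums over the modes. -/

section Powers

variable {H ι : Type*} [NormedAddCommGroup H] [InnerProductSpace ℝ H]
  {e : HilbertBasis ι ℝ H} {lam : ι → ℝ} {α : ℝ}

theorem rpow_two_mul_sq {x : ℝ} (hx : 0 ≤ x) (α : ℝ) : (x ^ (2 * α)) ^ 2 = x ^ (4 * α) := by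
  rw [← Real.rpow_natCast, ← Real.rpow_mul hx]
  congr 1; push_cast; ring

theorem summable_coord_sq (hlam : ∀ k, 0 ≤ lam k) {z : H} (hz : z ∈ PowDomain e lam α) :
    Summable fun k => (lam k ^ (2 * α) * inner ℝ (e k) z) ^ 2 := by
  refine Summable.congr hz fun k => ?_
  rw [mul_pow, rpow_two_mul_sq (hlam k)]

theorem inner_pow (hlam : ∀ k, 0 ≤ lam k) {z : H} (hz : z ∈ PowDomain e lam α) (k : ι) :
    inner ℝ (e k) (pow e lam α z) = lam k ^ (2 * α) * inner ℝ (e k) z := by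
  obtain ⟨y, hy, hyk⟩ := hasSum_of_summable_sq e (summable_coord_sq hlam hz)
  rw [pow, hy.tsum_eq, hyk]

theorem hasSum_pow (hlam : ∀ k, 0 ≤ lam k) {z : H} (hz : z ∈ PowDomain e lam α) :
    HasSum (fun k => lam k ^ (4 * α) * inner ℝ (e k) z ^ 2) (‖pow e lam α z‖ ^ 2) := by
  refine (hasSum_inner_sq e _).congr_fun fun k => ?_
  rw [inner_pow hlam hz, mul_pow, rpow_two_mul_sq (hlam k)]

theorem sub_mem_powDomain (hlam : ∀ k, 0 ≤ lam k) {x y : H} (hx : x ∈ PowDomain e lam α)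
    (hy : y ∈ PowDomain e lam α) : x - y ∈ PowDomain e lam α := by
  refine Summable.of_nonneg_of_le (fun k => ?_) (fun k => ?_) ((hx.add hy).mul_left 2)
  · have := Real.rpow_nonneg (hlam k) (4 * α)
    positivity
  · have := Real.rpow_nonneg (hlam k) (4 * α)
    rw [inner_sub_right, ← mul_add, mul_left_comm]
    refine mul_le_mul_of_nonneg_left ?_ this
    nlinarith [sq_nonneg (inner ℝ (e k) x + inner ℝ (e k) y)]

theorem pow_sub (hlam : ∀ k, 0 ≤ lam k) {x y : H} (hx : x ∈ PowDomain e lam α)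
    (hy : y ∈ PowDomain e lam α) :
    pow e lam α (x - y) = pow e lam α x - pow e lam α y := by
  refine eq_of_inner_eq e fun k => ?_
  rw [inner_pow hlam (sub_mem_powDomain hlam hx hy), inner_sub_right, inner_sub_right,
    inner_pow hlam hx, inner_pow hlam hy, mul_sub]

theorem rpow_four_quarter (x : ℝ) : x ^ (4 * (1 / 4 : ℝ)) = x := by
  norm_num

theorem rpow_four_half (x : ℝ) : x ^ (4 * (1 / 2 : ℝ)) = x ^ 2 := by
  norm_num

theorem rpow_four_threeQuarters (x : ℝ) : x ^ (4 * (3 / 4 : ℝ)) = x ^ 3 := by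
  rw [← Real.rpow_natCast]; norm_num

theorem mem_powDomain_quarter {z : H} :
    z ∈ PowDomain e lam (1 / 4) ↔ Summable fun k => lam k * inner ℝ (e k) z ^ 2 := by
  simp only [PowDomain, mem_ofPred_eq, rpow_four_quarter]

theorem mem_powDomain_half {z : H} :
    z ∈ PowDomain e lam (1 / 2) ↔ Summable fun k => lam k ^ 2 * inner ℝ (e k) z ^ 2 := by
  simp only [PowDomain, mem_ofPred_eq, rpow_four_half]

theorem mem_powDomain_threeQuarters {z : H} :
    z ∈ PowDomain e lam (3 / 4) ↔ Summable fun k => lam k ^ 3 * inner ℝ (e k) z ^ 2 := by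
  simp only [PowDomain, mem_ofPred_eq, rpow_four_threeQuarters]

theorem half_of_threeQuarters (hlam : ∀ k, 0 ≤ lam k) {z : H}
    (hz : z ∈ PowDomain e lam (3 / 4)) : z ∈ PowDomain e lam (1 / 2) := by
  rw [mem_powDomain_threeQuarters] at hz
  rw [mem_powDomain_half]
  refine Summable.of_nonneg_of_le (fun k => by positivity) (fun k => ?_)
    (hz.add (hasSum_inner_sq e z).summable)
  rw [← add_one_mul]
  refine mul_le_mul_of_nonneg_right ?_ (sq_nonneg _)
  nlinarith [hlam k, mul_nonneg (hlam k) (sq_nonneg (lam k - 1)), sq_nonneg (lam k - 1)]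

/-- The `k`-th mode of `|z₁|² + |A^{1/2} z₀|²`. -/
noncomputable def modeEnergy (e : HilbertBasis ι ℝ H) (lam : ι → ℝ) (z₀ z₁ : H) (k : ι) : ℝ :=
  inner ℝ (e k) z₁ ^ 2 + lam k ^ 2 * inner ℝ (e k) z₀ ^ 2

theorem modeEnergy_nonneg (z₀ z₁ : H) (k : ι) : 0 ≤ modeEnergy e lam z₀ z₁ k := by
  unfold modeEnergy; positivity

/-- The energy is the `(1 + lam k)`-weighted sum of the mode energies, so every estimate mode by
mode becomes an energy estimate by summation. -/
theorem hasSum_energy (hlam : ∀ k, 0 ≤ lam k) {z₀ z₁ : H} (h₀ : z₀ ∈ PowDomain e lam (3 / 4))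
    (h₁ : z₁ ∈ PowDomain e lam (1 / 4)) :
    HasSum (fun k => (1 + lam k) * modeEnergy e lam z₀ z₁ k) (energy e lam z₀ z₁) := by
  have a := hasSum_inner_sq e z₁
  have b := hasSum_pow hlam h₁
  have c := hasSum_pow hlam (half_of_threeQuarters hlam h₀)
  have d := hasSum_pow hlam h₀
  simp only [rpow_four_quarter, rpow_four_half, rpow_four_threeQuarters] at b c d
  refine (((a.add b).add c).add d).congr_fun fun k => ?_
  unfold modeEnergy; ring

theorem energy_nonneg (z₀ z₁ : H) : 0 ≤ energy e lam z₀ z₁ := by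
  unfold energy; positivity

end Powers

/-! ### The linear equation with a prescribed coefficient. -/

/-- Weak solutions on `[0, T]` of the linear equation `u'' + c(t) A u = 0`, with `v = u'`. -/
structure IsLinearSolution {H ι : Type*} [NormedAddCommGroup H] [InnerProductSpace ℝ H]
    (A : H →ₗ.[ℝ] H) (e : HilbertBasis ι ℝ H) (lam : ι → ℝ) (c : ℝ → ℝ)
    (u₀ u₁ : H) (T : ℝ) (u v : ℝ → H) : Prop where
  regular : IsC0Pow e lam (3 / 4) (Icc 0 T) u
  regular_deriv : IsC1Pow e lam (1 / 4) (Icc 0 T) u v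
  init : u 0 = u₀
  init_deriv : v 0 = u₁
  equation : ∀ φ : A.domain, ∀ t ∈ Icc 0 T,
    HasDerivWithinAt (fun s => inner ℝ (v s) (φ : H))
      (-(c t * inner ℝ (u t) (A φ))) (Icc 0 T) t

section LinearEquation

variable {H ι : Type*} [NormedAddCommGroup H] [InnerProductSpace ℝ H]
  {A : H →ₗ.[ℝ] H} {e : HilbertBasis ι ℝ H} {lam : ι → ℝ} {m c : ℝ → ℝ} {u₀ u₁ : H} {T : ℝ}
  {u v : ℝ → H}

theorem IsSolution.isLinearSolution (h : IsSolution A e lam m u₀ u₁ (Icc 0 T) u v) :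
    IsLinearSolution A e lam (fun t => m (‖pow e lam (1 / 2) (u t)‖ ^ 2)) u₀ u₁ T u v :=
  ⟨h.regular, h.regular_deriv, h.init, h.init_deriv, h.equation⟩

theorem IsLinearSolution.isSolution (h : IsLinearSolution A e lam c u₀ u₁ T u v)
    (hc : ∀ t ∈ Icc 0 T, m (‖pow e lam (1 / 2) (u t)‖ ^ 2) = c t) :
    IsSolution A e lam m u₀ u₁ (Icc 0 T) u v :=
  ⟨h.regular, h.regular_deriv, h.init, h.init_deriv, fun φ t ht => by
    rw [hc t ht]; exact h.equation φ t ht⟩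

theorem IsC0Pow.mono {α : ℝ} {I J : Set ℝ} {f : ℝ → H} (h : IsC0Pow e lam α I f) (hJ : J ⊆ I) :
    IsC0Pow e lam α J f :=
  ⟨fun t ht => h.1 t (hJ ht), h.2.1.mono hJ, h.2.2.mono hJ⟩

theorem IsSolution.mono {I J : Set ℝ} (h : IsSolution A e lam m u₀ u₁ I u v) (hJ : J ⊆ I) :
    IsSolution A e lam m u₀ u₁ J u v :=
  ⟨h.regular.mono hJ,
    ⟨fun t ht => h.regular_deriv.1 t (hJ ht), h.regular_deriv.2.1.mono hJ,
      fun t ht => (h.regular_deriv.2.2.1 t (hJ ht)).mono hJ,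
      fun t ht => (h.regular_deriv.2.2.2 t (hJ ht)).mono hJ⟩,
    h.init, h.init_deriv, fun φ t ht => (h.equation φ t (hJ ht)).mono hJ⟩

theorem hasDerivWithinAt_inner_left {I : Set ℝ} {f : ℝ → H} {f' : H} {t : ℝ}
    (h : HasDerivWithinAt f f' I t) (x : H) :
    HasDerivWithinAt (fun s => inner ℝ x (f s)) (inner ℝ x f') I t := by
  simpa using (hasDerivWithinAt_const t I x).inner ℝ h

theorem IsLinearSolution.isMode (h : IsLinearSolution A e lam c u₀ u₁ T u v)
    (hAe : ∀ k, ∃ hk : e k ∈ A.domain, A ⟨e k, hk⟩ = lam k ^ 2 • e k) (k : ι) :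
    IsMode T c (lam k) (fun t => inner ℝ (e k) (u t)) (fun t => inner ℝ (e k) (v t)) := by
  refine ⟨fun t ht => hasDerivWithinAt_inner_left (h.regular_deriv.2.2.1 t ht) _, fun t ht => ?_⟩
  obtain ⟨hk, hAk⟩ := hAe k
  have := h.equation ⟨e k, hk⟩ t ht
  rw [hAk, inner_smul_right] at this
  simpa only [real_inner_comm] using this

/-- A bound for `|A^{3/4} u|` and `|A^{1/4} u'|` yields a Lipschitz bound for `|A^{1/2} u|²`. -/
theorem IsLinearSolution.abs_sq_sub_sq_le (hlam : ∀ k, 0 ≤ lam k)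
    (h : IsLinearSolution A e lam c u₀ u₁ T u v) {U V : ℝ}
    (hU : ∀ t ∈ Icc 0 T, ‖pow e lam (3 / 4) (u t)‖ ≤ U)
    (hV : ∀ t ∈ Icc 0 T, ‖pow e lam (1 / 4) (v t)‖ ≤ V) :
    ∀ s ∈ Icc 0 T, ∀ t ∈ Icc 0 T,
      |‖pow e lam (1 / 2) (u t)‖ ^ 2 - ‖pow e lam (1 / 2) (u s)‖ ^ 2| ≤ 2 * V * U * |t - s| := by
  intro s hs t ht
  have hV0 : 0 ≤ V := (norm_nonneg _).trans (hV t ht)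
  have h1 := (convex_Icc (0 : ℝ) T).norm_image_sub_le_of_norm_hasDerivWithin_le
    h.regular_deriv.2.2.2 hV hs ht
  have hmem := h.regular.1
  have hmem' := h.regular_deriv.1
  set a := pow e lam (1 / 4) (u t) - pow e lam (1 / 4) (u s) with ha
  set b := pow e lam (3 / 4) (u t) + pow e lam (3 / 4) (u s) with hb
  have h2 := e.hasSum_inner_mul_inner a b
  have h3 := (hasSum_pow hlam (half_of_threeQuarters hlam (hmem t ht))).sub
    (hasSum_pow hlam (half_of_threeQuarters hlam (hmem s hs)))
  -- The factors `A^{1/4}` and `A^{3/4}` recombine to `A^{1/2}` twice. Only `A^{1/4} u` is known to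
  -- be differentiable in time, so the increment is placed on that factor.
  have h4 : inner ℝ a b
      = ‖pow e lam (1 / 2) (u t)‖ ^ 2 - ‖pow e lam (1 / 2) (u s)‖ ^ 2 := by
    refine (h2.congr_fun fun k => ?_).unique h3
    have hr : lam k ^ (2 * (1 / 4 : ℝ)) * lam k ^ (2 * (3 / 4 : ℝ)) = lam k ^ 2 := by
      rw [← Real.rpow_add_of_nonneg (hlam k) (by norm_num) (by norm_num)]
      norm_num
    rw [rpow_four_half, ← hr, real_inner_comm (e k) a, ha, hb, inner_sub_right, inner_add_right,
      inner_pow hlam (hmem t ht), inner_pow hlam (hmem s hs), inner_pow hlam (hmem' t ht),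
      inner_pow hlam (hmem' s hs)]
    ring
  rw [← h4]
  have hb' : ‖b‖ ≤ 2 * U := (norm_add_le _ _).trans (by linarith [hU t ht, hU s hs])
  calc |inner ℝ a b| ≤ ‖a‖ * ‖b‖ := abs_real_inner_le_norm a b
    _ ≤ (V * ‖t - s‖) * (2 * U) := by gcongr
    _ = _ := by rw [Real.norm_eq_abs]; ring

theorem inner_apply_eq [CompleteSpace H] (hA : IsSelfAdjoint A)
    (hAe : ∀ k, ∃ hk : e k ∈ A.domain, A ⟨e k, hk⟩ = lam k ^ 2 • e k) (φ : A.domain) (k : ι) :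
    inner ℝ (e k) (A φ) = lam k ^ 2 * inner ℝ (e k) (φ : H) := by
  obtain ⟨hk, hAk⟩ := hAe k
  have h1 := LinearPMap.adjoint_isFormalAdjoint hA.dense_domain
  rw [LinearPMap.isSelfAdjoint_def.1 hA] at h1
  have h2 := h1 ⟨e k, hk⟩ φ
  rw [hAk, inner_smul_left] at h2
  simpa using h2.symm

theorem summable_modeEnergy (hlam : ∀ k, 0 ≤ lam k) {z₀ z₁ : H}
    (h₀ : z₀ ∈ PowDomain e lam (3 / 4)) (h₁ : z₁ ∈ PowDomain e lam (1 / 4)) :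
    Summable (modeEnergy e lam z₀ z₁) :=
  (hasSum_energy hlam h₀ h₁).summable.of_nonneg_of_le (modeEnergy_nonneg z₀ z₁) fun k =>
    le_mul_of_one_le_left (modeEnergy_nonneg _ _ _) (by linarith [hlam k])

theorem summable_lam_mul_modeEnergy (hlam : ∀ k, 0 ≤ lam k) {z₀ z₁ : H}
    (h₀ : z₀ ∈ PowDomain e lam (3 / 4)) (h₁ : z₁ ∈ PowDomain e lam (1 / 4)) :
    Summable fun k => lam k * modeEnergy e lam z₀ z₁ k :=
  (hasSum_energy hlam h₀ h₁).summable.of_nonneg_of_le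
    (fun k => mul_nonneg (hlam k) (modeEnergy_nonneg z₀ z₁ k)) fun k =>
    mul_le_mul_of_nonneg_right (by linarith) (modeEnergy_nonneg _ _ _)

/-- The modes are solved separately and reassembled. The energy bound supplies the time-independent
summable majorants `C * q k` and `lam k * (C * q k)`, from which the stronger regularity follows. -/
theorem exists_isLinearSolution [CompleteSpace H] (hA : IsSelfAdjoint A) (hlam : ∀ k, 0 ≤ lam k)
    (hAe : ∀ k, ∃ hk : e k ∈ A.domain, A ⟨e k, hk⟩ = lam k ^ 2 • e k)
    {ν M L : ℝ} (hν : 0 < ν) (hν1 : ν ≤ 1) (hM : 1 ≤ M) (hL : 0 ≤ L) (hT : 0 < T)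
    (hc : IsCoeff T ν M L c)
    (h₀ : u₀ ∈ PowDomain e lam (3 / 4)) (h₁ : u₁ ∈ PowDomain e lam (1 / 4)) :
    ∃ u v : ℝ → H, IsLinearSolution A e lam c u₀ u₁ T u v := by
  have hcM : ∀ t ∈ Icc 0 T, |c t| ≤ M := fun t ht =>
    abs_le.2 ⟨by linarith [hc.lower t ht], hc.upper t ht⟩
  have hcc : ContinuousOn c (Icc 0 T) := by
    have hL' : LipschitzOnWith (Real.toNNReal L) c (Icc 0 T) :=
      LipschitzOnWith.of_dist_le_mul fun a ha b hb => by
        rw [Real.dist_eq, Real.dist_eq, Real.coe_toNNReal L hL]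
        exact hc.lip b hb a ha
    exact hL'.continuousOn
  choose x y hx0 hy0 hx hy using fun k =>
    exists_mode_solution (lam := lam k) hT hcc hcM (inner ℝ (e k) u₀) (inner ℝ (e k) u₁)
  set C := growth T ν M L with hC
  have hC0 : 0 ≤ C := growth_nonneg hν hM
  set q := modeEnergy e lam u₀ u₁ with hq
  have hq0 : ∀ k, 0 ≤ q k := modeEnergy_nonneg u₀ u₁
  have hE : ∀ k, ∀ t ∈ Icc 0 T, y k t ^ 2 + lam k ^ 2 * x k t ^ 2 ≤ C * q k := by
    intro k t ht
    have := IsMode.energy_le hν hν1 hM hL hc (lam := lam k) ⟨hx k, hy k⟩ t ht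
    rwa [hx0, hy0] at this
  have hsq : Summable fun k => C * q k := (summable_modeEnergy hlam h₀ h₁).mul_left C
  have hslq : Summable fun k => lam k * (C * q k) :=
    ((summable_lam_mul_modeEnergy hlam h₀ h₁).mul_left C).congr fun k => by ring
  have hyb : ∀ k, ∀ t ∈ Icc 0 T, y k t ^ 2 ≤ C * q k := fun k t ht => by
    have : 0 ≤ lam k ^ 2 * x k t ^ 2 := by positivity
    linarith [hE k t ht]
  -- The energy does not control `x k` itself where `lam k` is small or zero, so this majorant comes
  -- from integrating the bound on `y k` over a time at most `T`.
  set S : ι → ℝ := fun k => 2 * inner ℝ (e k) u₀ ^ 2 + 2 * (T ^ 2 * (C * q k)) with hS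
  have hSs : Summable S :=
    ((hasSum_inner_sq e u₀).summable.mul_left 2).add ((hsq.mul_left (T ^ 2)).mul_left 2)
  have hxb : ∀ k, ∀ t ∈ Icc 0 T, x k t ^ 2 ≤ S k := by
    intro k t ht
    have h0 : (0 : ℝ) ∈ Icc 0 T := ⟨le_rfl, hT.le⟩
    have h1 := (convex_Icc (0 : ℝ) T).norm_image_sub_le_of_norm_hasDerivWithin_le (hx k)
      (fun s hs => Real.abs_le_sqrt (hyb k s hs)) h0 ht
    rw [hx0, sub_zero, Real.norm_eq_abs, Real.norm_eq_abs, abs_of_nonneg ht.1] at h1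
    have h2 : (x k t - inner ℝ (e k) u₀) ^ 2 ≤ T ^ 2 * (C * q k) := by
      rw [← sq_abs]
      calc _ ≤ (√(C * q k) * T) ^ 2 := by
            gcongr
            refine h1.trans ?_
            gcongr
            exact ht.2
        _ = _ := by rw [mul_pow, Real.sq_sqrt (mul_nonneg hC0 (hq0 k)), mul_comm]
    simp only [hS]
    nlinarith [sq_nonneg (x k t - 2 * inner ℝ (e k) u₀)]
  have hx3b : ∀ k, ∀ t ∈ Icc 0 T, lam k ^ 3 * x k t ^ 2 ≤ lam k * (C * q k) := by
    intro k t ht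
    have h1 : lam k ^ 2 * x k t ^ 2 ≤ C * q k := by linarith [hE k t ht, sq_nonneg (y k t)]
    calc lam k ^ 3 * x k t ^ 2 = lam k * (lam k ^ 2 * x k t ^ 2) := by ring
      _ ≤ _ := mul_le_mul_of_nonneg_left h1 (hlam k)
  have hy1b : ∀ k, ∀ t ∈ Icc 0 T, lam k * y k t ^ 2 ≤ lam k * (C * q k) := fun k t ht =>
    mul_le_mul_of_nonneg_left (hyb k t ht) (hlam k)
  have hw : ∀ t, ∃ z : H, t ∈ Icc 0 T → ∀ k, inner ℝ (e k) z = x k t := fun t => by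
    by_cases ht : t ∈ Icc 0 T
    · obtain ⟨z, -, hz⟩ := hasSum_of_summable_sq e (f := fun k => x k t)
        (hSs.of_nonneg_of_le (fun k => sq_nonneg _) fun k => hxb k t ht)
      exact ⟨z, fun _ => hz⟩
    · exact ⟨0, fun h => (ht h).elim⟩
  have hw' : ∀ t, ∃ z : H, t ∈ Icc 0 T → ∀ k, inner ℝ (e k) z = y k t := fun t => by
    by_cases ht : t ∈ Icc 0 T
    · obtain ⟨z, -, hz⟩ := hasSum_of_summable_sq e (f := fun k => y k t)
        (hsq.of_nonneg_of_le (fun k => sq_nonneg _) fun k => hyb k t ht)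
      exact ⟨z, fun _ => hz⟩
    · exact ⟨0, fun h => (ht h).elim⟩
  choose w hwk using hw
  choose w' hwk' using hw'
  have hxc : ∀ k, ContinuousOn (x k) (Icc 0 T) := fun k t ht => (hx k t ht).continuousWithinAt
  have hyc : ∀ k, ContinuousOn (y k) (Icc 0 T) := fun k t ht => (hy k t ht).continuousWithinAt
  have hmem3 : ∀ t ∈ Icc 0 T, w t ∈ PowDomain e lam (3 / 4) := fun t ht => by
    rw [mem_powDomain_threeQuarters]
    refine hslq.of_nonneg_of_le (fun k => mul_nonneg (pow_nonneg (hlam k) 3) (sq_nonneg _))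
      fun k => ?_
    rw [hwk t ht]; exact hx3b k t ht
  have hmem1 : ∀ t ∈ Icc 0 T, w t ∈ PowDomain e lam (1 / 4) := fun t ht => by
    rw [mem_powDomain_quarter]
    refine (hSs.add hsq).of_nonneg_of_le (fun k => mul_nonneg (hlam k) (sq_nonneg _))
      fun k => ?_
    rw [hwk t ht]
    have h1 : lam k ^ 2 * x k t ^ 2 ≤ C * q k := by linarith [hE k t ht, sq_nonneg (y k t)]
    have h2 : lam k ≤ 1 + lam k ^ 2 := by nlinarith [sq_nonneg (lam k - 1)]
    calc lam k * x k t ^ 2 ≤ (1 + lam k ^ 2) * x k t ^ 2 := by gcongr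
      _ ≤ _ := by linarith [hxb k t ht]
  have hmem1' : ∀ t ∈ Icc 0 T, w' t ∈ PowDomain e lam (1 / 4) := fun t ht => by
    rw [mem_powDomain_quarter]
    refine hslq.of_nonneg_of_le (fun k => mul_nonneg (hlam k) (sq_nonneg _)) fun k => ?_
    rw [hwk' t ht]; exact hy1b k t ht
  have hsq1' : ∀ t ∈ Icc 0 T, ∀ k,
      inner ℝ (e k) (pow e lam (1 / 4) (w' t)) ^ 2 ≤ lam k * (C * q k) := fun t ht k => by
    rw [inner_pow hlam (hmem1' t ht), mul_pow, rpow_two_mul_sq (hlam k), rpow_four_quarter,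
      hwk' t ht]
    exact hy1b k t ht
  refine ⟨w, w', ⟨hmem3, ?_, ?_⟩, ⟨hmem1, ⟨hmem1', ?_, ?_⟩, ?_, ?_⟩, ?_, ?_, ?_⟩
  · refine continuousOn_of_inner e hSs (fun t ht k => ?_) fun k => ?_
    · rw [hwk t ht]; exact hxb k t ht
    · exact (hxc k).congr fun t ht => hwk t ht k
  · refine continuousOn_of_inner e hslq (fun t ht k => ?_) fun k => ?_
    · rw [inner_pow hlam (hmem3 t ht), mul_pow, rpow_two_mul_sq (hlam k), rpow_four_threeQuarters,
        hwk t ht]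
      exact hx3b k t ht
    · refine ((hxc k).const_smul (lam k ^ (2 * (3 / 4 : ℝ)))).congr fun t ht => ?_
      rw [inner_pow hlam (hmem3 t ht), hwk t ht]; rfl
  · refine continuousOn_of_inner e hsq (fun t ht k => ?_) fun k => ?_
    · rw [hwk' t ht]; exact hyb k t ht
    · exact (hyc k).congr fun t ht => hwk' t ht k
  · refine continuousOn_of_inner e hslq hsq1' fun k => ?_
    refine ((hyc k).const_smul (lam k ^ (2 * (1 / 4 : ℝ)))).congr fun t ht => ?_
    rw [inner_pow hlam (hmem1' t ht), hwk' t ht]; rfl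
  · refine hasDerivWithinAt_of_inner e hsq (fun t ht k => ?_) fun k t ht => ?_
    · rw [hwk' t ht]; exact hyb k t ht
    · rw [hwk' t ht]
      exact (hx k t ht).congr (fun s hs => hwk s hs k) (hwk t ht k)
  · refine hasDerivWithinAt_of_inner e hslq hsq1' fun k t ht => ?_
    rw [inner_pow hlam (hmem1' t ht), hwk' t ht]
    refine ((hx k t ht).const_mul (lam k ^ (2 * (1 / 4 : ℝ)))).congr (fun s hs => ?_) ?_
    · rw [inner_pow hlam (hmem1 s hs), hwk s hs]
    · rw [inner_pow hlam (hmem1 t ht), hwk t ht]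
  · exact eq_of_inner_eq e fun k => by rw [hwk 0 ⟨le_rfl, hT.le⟩, hx0]
  · exact eq_of_inner_eq e fun k => by rw [hwk' 0 ⟨le_rfl, hT.le⟩, hy0]
  · intro φ t ht
    have hexp : ∀ a b : H, HasSum (fun k => inner ℝ (e k) a * inner ℝ (e k) b) (inner ℝ a b) :=
      fun a b => (e.hasSum_inner_mul_inner a b).congr_fun fun k => by
        rw [real_inner_comm a (e k)]
    have hd := hasDerivWithinAt_tsum_of_bound (T := T)
      (f := fun k s => y k s * inner ℝ (e k) (φ : H))
      (g := fun k s => -(c s * (x k s * inner ℝ (e k) (A φ))))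
      (b := fun k => M * (S k + inner ℝ (e k) (A φ) ^ 2))
      ((hSs.add (hasSum_inner_sq e (A φ)).summable).mul_left M)
      (fun s hs k => by
        rw [abs_neg, abs_mul]
        refine mul_le_mul (hcM s hs) ?_ (abs_nonneg _) (by linarith)
        have h1 := hxb k s hs
        rw [abs_le]
        constructor
        · nlinarith [sq_nonneg (x k s + inner ℝ (e k) (A φ)), sq_nonneg (x k s),
            sq_nonneg (inner ℝ (e k) (A φ))]
        · nlinarith [sq_nonneg (x k s - inner ℝ (e k) (A φ)), sq_nonneg (x k s),
            sq_nonneg (inner ℝ (e k) (A φ))])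
      (fun s hs => (hexp (w' s) φ).summable.congr fun k => by rw [hwk' s hs])
      (fun k s hs => ((hy k s hs).mul_const (inner ℝ (e k) (φ : H))).congr_deriv (by
        rw [inner_apply_eq hA hAe]; ring)) t ht
    have hval : ∑' k, -(c t * (x k t * inner ℝ (e k) (A φ))) = -(c t * inner ℝ (w t) (A φ)) := by
      rw [tsum_neg, tsum_mul_left]
      congr 2
      rw [← (hexp (w t) (A φ)).tsum_eq]
      exact tsum_congr fun k => by rw [hwk t ht]
    rw [hval] at hd
    have hinner : ∀ s ∈ Icc 0 T, inner ℝ (w' s) (φ : H) = ∑' k, y k s * inner ℝ (e k) (φ : H) :=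
      fun s hs => by
        rw [← (hexp (w' s) φ).tsum_eq]
        exact tsum_congr fun k => by rw [hwk' s hs]
    exact hd.congr hinner (hinner t ht)

end LinearEquation

/-! ### Dependence of linear solutions on coefficient and data. -/

section Dependence

variable {H ι : Type*} [NormedAddCommGroup H] [InnerProductSpace ℝ H]
  {A : H →ₗ.[ℝ] H} {e : HilbertBasis ι ℝ H} {lam : ι → ℝ}
  {T ν M L : ℝ} {c c₁ c₂ : ℝ → ℝ} {u₀ u₁ w₀ w₁ : H} {u v w w' : ℝ → H}

theorem IsLinearSolution.modeEnergy_le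
    (hAe : ∀ k, ∃ hk : e k ∈ A.domain, A ⟨e k, hk⟩ = lam k ^ 2 • e k)
    (hν : 0 < ν) (hν1 : ν ≤ 1) (hM : 1 ≤ M) (hL : 0 ≤ L) (hc : IsCoeff T ν M L c)
    (h : IsLinearSolution A e lam c u₀ u₁ T u v) {t : ℝ} (ht : t ∈ Icc 0 T) (k : ι) :
    modeEnergy e lam (u t) (v t) k ≤ growth T ν M L * modeEnergy e lam u₀ u₁ k := by
  have := (h.isMode hAe k).energy_le hν hν1 hM hL hc t ht
  rwa [h.init, h.init_deriv] at this

theorem IsLinearSolution.sub_modeEnergy_le (hlam : ∀ k, 0 ≤ lam k)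
    (hAe : ∀ k, ∃ hk : e k ∈ A.domain, A ⟨e k, hk⟩ = lam k ^ 2 • e k)
    (hν : 0 < ν) (hν1 : ν ≤ 1) (hM : 1 ≤ M) (hL : 0 ≤ L)
    (hc₁ : IsCoeff T ν M L c₁) (hc₂ : IsCoeff T ν M L c₂)
    (hw : IsLinearSolution A e lam c₁ w₀ w₁ T w w')
    (hu : IsLinearSolution A e lam c₂ u₀ u₁ T u v) {κ B : ℝ} (hκ : 2 * L / ν + 1 ≤ κ)
    (hB : 0 ≤ B) (hcc : ∀ t ∈ Icc 0 T, |c₁ t - c₂ t| ≤ B * Real.exp (κ * t))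
    {t : ℝ} (ht : t ∈ Icc 0 T) (k : ι) :
    modeEnergy e lam (w t - u t) (w' t - v t) k
      ≤ 2 * growth T ν M L / ν * Real.exp (2 * κ * t) *
        (modeEnergy e lam (w₀ - u₀) (w₁ - u₁) k
          + B ^ 2 / κ ^ 2 * (lam k ^ 2 * modeEnergy e lam u₀ u₁ k)) := by
  have := (hw.isMode hAe k).sub_energy_le hν hν1 hM hL (hlam k) hκ hB hc₁ hc₂ (hu.isMode hAe k)
    hcc t ht
  rw [hw.init, hw.init_deriv, hu.init, hu.init_deriv] at this
  simpa only [modeEnergy, inner_sub_right] using this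

theorem modeEnergy_sub_le (x₀ x₁ y₀ y₁ : H) (k : ι) :
    modeEnergy e lam (x₀ - y₀) (x₁ - y₁) k
      ≤ 2 * (modeEnergy e lam x₀ x₁ k + modeEnergy e lam y₀ y₁ k) := by
  have key : ∀ a b : ℝ, (a - b) ^ 2 ≤ 2 * (a ^ 2 + b ^ 2) := fun a b => by
    nlinarith [sq_nonneg (a + b)]
  unfold modeEnergy
  rw [inner_sub_right, inner_sub_right]
  have h1 := key (inner ℝ (e k) x₁) (inner ℝ (e k) y₁)
  have h2 := mul_le_mul_of_nonneg_left (key (inner ℝ (e k) x₀) (inner ℝ (e k) y₀))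
    (sq_nonneg (lam k))
  linarith

theorem modeEnergy_le_sub_add (x₀ x₁ y₀ y₁ : H) (k : ι) :
    modeEnergy e lam x₀ x₁ k
      ≤ 2 * (modeEnergy e lam (x₀ - y₀) (x₁ - y₁) k + modeEnergy e lam y₀ y₁ k) := by
  have key : ∀ a b : ℝ, a ^ 2 ≤ 2 * ((a - b) ^ 2 + b ^ 2) := fun a b => by
    nlinarith [sq_nonneg (a - 2 * b)]
  unfold modeEnergy
  rw [inner_sub_right, inner_sub_right]
  have h1 := key (inner ℝ (e k) x₁) (inner ℝ (e k) y₁)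
  have h2 := mul_le_mul_of_nonneg_left (key (inner ℝ (e k) x₀) (inner ℝ (e k) y₀))
    (sq_nonneg (lam k))
  linarith

theorem energy_le_sub_add (hlam : ∀ k, 0 ≤ lam k) {x₀ x₁ y₀ y₁ : H}
    (hx₀ : x₀ ∈ PowDomain e lam (3 / 4)) (hx₁ : x₁ ∈ PowDomain e lam (1 / 4))
    (hy₀ : y₀ ∈ PowDomain e lam (3 / 4)) (hy₁ : y₁ ∈ PowDomain e lam (1 / 4)) :
    energy e lam x₀ x₁ ≤ 2 * (energy e lam (x₀ - y₀) (x₁ - y₁) + energy e lam y₀ y₁) := by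
  refine hasSum_le (fun k => ?_) (hasSum_energy hlam hx₀ hx₁)
    (((hasSum_energy hlam (sub_mem_powDomain hlam hx₀ hy₀) (sub_mem_powDomain hlam hx₁ hy₁)).add
      (hasSum_energy hlam hy₀ hy₁)).mul_left 2)
  have := mul_le_mul_of_nonneg_left (modeEnergy_le_sub_add (e := e) (lam := lam) x₀ x₁ y₀ y₁ k)
    (by linarith [hlam k] : 0 ≤ 1 + lam k)
  linarith

/-- Solutions with close coefficients and close initial data stay close in the energy norm,
without a rate. -/
theorem IsLinearSolution.exists_energy_sub_lt (hlam : ∀ k, 0 ≤ lam k)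
    (hAe : ∀ k, ∃ hk : e k ∈ A.domain, A ⟨e k, hk⟩ = lam k ^ 2 • e k)
    (hν : 0 < ν) (hν1 : ν ≤ 1) (hM : 1 ≤ M) (hL : 0 ≤ L) (hc₂ : IsCoeff T ν M L c₂)
    (h₀ : u₀ ∈ PowDomain e lam (3 / 4)) (h₁ : u₁ ∈ PowDomain e lam (1 / 4))
    (hu : IsLinearSolution A e lam c₂ u₀ u₁ T u v) {δ : ℝ} (hδ : 0 < δ) :
    ∃ η > 0, ∀ (c₁ : ℝ → ℝ) (w₀ w₁ : H) (w w' : ℝ → H), IsCoeff T ν M L c₁ →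
      w₀ ∈ PowDomain e lam (3 / 4) → w₁ ∈ PowDomain e lam (1 / 4) →
      IsLinearSolution A e lam c₁ w₀ w₁ T w w' →
      (∀ t ∈ Icc 0 T, |c₁ t - c₂ t| ≤ η) → energy e lam (w₀ - u₀) (w₁ - u₁) ≤ η →
      ∀ t ∈ Icc 0 T, energy e lam (w t - u t) (w' t - v t) < δ := by
  set κ := 2 * L / ν + 1 with hκ
  have hκ1 : 1 ≤ κ := by
    have : 0 ≤ 2 * L / ν := by positivity
    linarith
  set C := growth T ν M L with hC
  have hC0 : 0 ≤ C := growth_nonneg hν hM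
  -- One constant serving both mode bounds below: the first term is for the difference estimate, and
  -- `6 * C` is for the triangle inequality combined with the separate bounds.
  set D := 2 * C / ν * Real.exp (2 * κ * T) + 6 * C with hD
  have hD0 : 0 ≤ D := by positivity
  set q := modeEnergy e lam u₀ u₁ with hq
  have hq0 : ∀ k, 0 ≤ q k := modeEnergy_nonneg u₀ u₁
  have hqs := (hasSum_energy hlam h₀ h₁).summable
  have hl1 : ∀ k, 0 ≤ 1 + lam k := fun k => by linarith [hlam k]
  -- The difference estimate gives `η² lam² q` and the crude bound gives `q`. Their minimum tends to
  -- 0 with `η` for each mode and is dominated by `q`, so the lost derivative costs only the rate of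
  -- convergence.
  set F : ℝ → ι → ℝ := fun η k => (1 + lam k) * (min 1 (η ^ 2 * lam k ^ 2) * q k) with hF
  have hF0 : ∀ η k, 0 ≤ F η k := fun η k =>
    mul_nonneg (hl1 k) (mul_nonneg (le_min zero_le_one (by positivity)) (hq0 k))
  have hFle : ∀ η k, F η k ≤ (1 + lam k) * q k := fun η k =>
    mul_le_mul_of_nonneg_left (mul_le_of_le_one_left (hq0 k) (min_le_left _ _)) (hl1 k)
  have hFs : ∀ η, Summable (F η) := fun η => hqs.of_nonneg_of_le (hF0 η) (hFle η)
  have hlim : Tendsto (fun η => D * (η + ∑' k, F η k)) (𝓝[>] 0) (𝓝 0) := by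
    have h2 : Tendsto (fun η => ∑' k, F η k) (𝓝[>] 0) (𝓝 (∑' _ : ι, (0 : ℝ))) := by
      refine tendsto_tsum_of_dominated_convergence hqs (fun k => ?_)
        (Eventually.of_forall fun η k => ?_)
      · have : Continuous fun η : ℝ => F η k := by simp only [hF]; fun_prop
        have h3 := this.tendsto 0
        simp [hF] at h3
        exact tendsto_nhdsWithin_of_tendsto_nhds h3
      · rw [Real.norm_eq_abs, abs_of_nonneg (hF0 η k)]
        exact hFle η k
    rw [tsum_zero] at h2
    have h3 : Tendsto (fun η : ℝ => η) (𝓝[>] 0) (𝓝 0) :=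
      tendsto_nhdsWithin_of_tendsto_nhds tendsto_id
    simpa using (h3.add h2).const_mul D
  obtain ⟨η, hηlt, hη⟩ := ((hlim.eventually_lt_const hδ).and self_mem_nhdsWithin).exists
  refine ⟨η, hη, fun c₁ w₀ w₁ w w' hc₁ hw₀ hw₁ hw hcc hen t ht => ?_⟩
  refine lt_of_le_of_lt ?_ hηlt
  have hη0 : 0 < η := hη
  have hd₀ := sub_mem_powDomain hlam hw₀ h₀
  have hd₁ := sub_mem_powDomain hlam hw₁ h₁
  have hsum := hasSum_energy hlam (sub_mem_powDomain hlam (hw.regular.1 t ht) (hu.regular.1 t ht))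
    (sub_mem_powDomain hlam (hw.regular_deriv.2.1.1 t ht) (hu.regular_deriv.2.1.1 t ht))
  have hsum2 := (((hasSum_energy hlam hd₀ hd₁).add (hFs η).hasSum).mul_left D)
  refine (hasSum_le (fun k => ?_) hsum hsum2).trans
    (mul_le_mul_of_nonneg_left (by linarith) hD0)
  have hz0 := modeEnergy_nonneg (e := e) (lam := lam) (w₀ - u₀) (w₁ - u₁) k
  have b1 := hw.sub_modeEnergy_le hlam hAe hν hν1 hM hL hc₁ hc₂ hu (κ := κ) le_rfl hη0.le
    (fun s hs => (hcc s hs).trans (le_mul_of_one_le_right hη0.le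
      (Real.one_le_exp (mul_nonneg (by linarith) hs.1)))) ht k
  have b1' : modeEnergy e lam (w t - u t) (w' t - v t) k ≤
      D * (modeEnergy e lam (w₀ - u₀) (w₁ - u₁) k + η ^ 2 * lam k ^ 2 * q k) := by
    refine b1.trans ?_
    have e1 : η ^ 2 / κ ^ 2 * (lam k ^ 2 * modeEnergy e lam u₀ u₁ k)
        ≤ η ^ 2 * lam k ^ 2 * q k := by
      rw [mul_assoc]
      refine mul_le_mul_of_nonneg_right ?_ (mul_nonneg (sq_nonneg _) (hq0 k))
      exact div_le_self (sq_nonneg _) (one_le_pow₀ hκ1)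
    have e2 : Real.exp (2 * κ * t) ≤ Real.exp (2 * κ * T) := by
      gcongr; exact ht.2
    have e3 : 2 * C / ν * Real.exp (2 * κ * t) ≤ D := by
      have := mul_le_mul_of_nonneg_left e2 (by positivity : 0 ≤ 2 * C / ν)
      linarith
    have e4 : 0 ≤ η ^ 2 / κ ^ 2 * (lam k ^ 2 * modeEnergy e lam u₀ u₁ k) :=
      mul_nonneg (by positivity) (mul_nonneg (sq_nonneg _) (hq0 k))
    exact mul_le_mul e3 (by linarith) (by linarith) hD0
  have b2 : modeEnergy e lam (w t - u t) (w' t - v t) k ≤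
      D * (modeEnergy e lam (w₀ - u₀) (w₁ - u₁) k + q k) := by
    have e1 := hw.modeEnergy_le hAe hν hν1 hM hL hc₁ ht k
    have e2 := hu.modeEnergy_le hAe hν hν1 hM hL hc₂ ht k
    have e3 := modeEnergy_sub_le (e := e) (lam := lam) (w t) (w' t) (u t) (v t) k
    have e4 := modeEnergy_le_sub_add (e := e) (lam := lam) w₀ w₁ u₀ u₁ k
    have e5 : C * modeEnergy e lam w₀ w₁ k
        ≤ C * (2 * (modeEnergy e lam (w₀ - u₀) (w₁ - u₁) k + q k)) :=
      mul_le_mul_of_nonneg_left e4 hC0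
    have e6 : 6 * C * (modeEnergy e lam (w₀ - u₀) (w₁ - u₁) k + q k)
        ≤ D * (modeEnergy e lam (w₀ - u₀) (w₁ - u₁) k + q k) := by
      refine mul_le_mul_of_nonneg_right ?_ (add_nonneg hz0 (hq0 k))
      have : 0 ≤ 2 * C / ν * Real.exp (2 * κ * T) := by positivity
      linarith
    have e7 := mul_nonneg hC0 hz0
    have e8 := mul_nonneg hC0 (hq0 k)
    simp only [← hq, ← hC] at e1 e2
    linarith
  have b3 : modeEnergy e lam (w t - u t) (w' t - v t) k ≤
      D * (modeEnergy e lam (w₀ - u₀) (w₁ - u₁) k + min 1 (η ^ 2 * lam k ^ 2) * q k) := by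
    rcases min_choice 1 (η ^ 2 * lam k ^ 2) with h | h
    · rw [h, one_mul]; exact b2
    · rw [h]; exact b1'
  refine (mul_le_mul_of_nonneg_left b3 (hl1 k)).trans (le_of_eq ?_)
  simp only [hF]; ring

theorem sq_le_mul_of_hasSum {f g : ι → ℝ} {x a b : ℝ} (hx : HasSum (fun k => f k * g k) x)
    (ha : HasSum (fun k => f k ^ 2) a) (hb : HasSum (fun k => g k ^ 2) b) : x ^ 2 ≤ a * b :=
  le_of_tendsto_of_tendsto' (Tendsto.pow hx 2) (Tendsto.mul ha hb)
    fun s => Finset.sum_mul_sq_le_sq_mul_sq s f g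

/-- Lipschitz dependence of `|A^{1/2} u|²` on the coefficient and on the initial data. -/
theorem IsLinearSolution.sq_sub_sq_le (hlam : ∀ k, 0 ≤ lam k)
    (hAe : ∀ k, ∃ hk : e k ∈ A.domain, A ⟨e k, hk⟩ = lam k ^ 2 • e k)
    (hν : 0 < ν) (hν1 : ν ≤ 1) (hM : 1 ≤ M) (hL : 0 ≤ L)
    (hc₁ : IsCoeff T ν M L c₁) (hc₂ : IsCoeff T ν M L c₂)
    (hw₀ : w₀ ∈ PowDomain e lam (3 / 4)) (hw₁ : w₁ ∈ PowDomain e lam (1 / 4))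
    (hu₀ : u₀ ∈ PowDomain e lam (3 / 4)) (hu₁ : u₁ ∈ PowDomain e lam (1 / 4))
    (hw : IsLinearSolution A e lam c₁ w₀ w₁ T w w')
    (hu : IsLinearSolution A e lam c₂ u₀ u₁ T u v) {κ B R : ℝ} (hκ : 2 * L / ν + 1 ≤ κ)
    (hB : 0 ≤ B) (hcc : ∀ t ∈ Icc 0 T, |c₁ t - c₂ t| ≤ B * Real.exp (κ * t))
    (hwR : energy e lam w₀ w₁ ≤ R) (huR : energy e lam u₀ u₁ ≤ R)
    {t : ℝ} (ht : t ∈ Icc 0 T) :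
    (‖pow e lam (1 / 2) (w t)‖ ^ 2 - ‖pow e lam (1 / 2) (u t)‖ ^ 2) ^ 2
      ≤ 8 * growth T ν M L ^ 2 / ν * R *
        (energy e lam (w₀ - u₀) (w₁ - u₁) + B ^ 2 / κ ^ 2 * R) * Real.exp (2 * κ * t) := by
  set C := growth T ν M L with hC
  have hC0 : 0 ≤ C := growth_nonneg hν hM
  have hR : 0 ≤ R := (energy_nonneg _ _).trans huR
  have hl1 : ∀ k, 0 < 1 + lam k := fun k => by linarith [hlam k]
  set X := 2 * C / ν * Real.exp (2 * κ * t) with hX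
  have hX0 : 0 ≤ X := by positivity
  have hwt := hasSum_pow hlam (half_of_threeQuarters hlam (hw.regular.1 t ht))
  have hut := hasSum_pow hlam (half_of_threeQuarters hlam (hu.regular.1 t ht))
  have hd₀ := sub_mem_powDomain hlam hw₀ hu₀
  have hd₁ := sub_mem_powDomain hlam hw₁ hu₁
  -- The weight `√(1 + lam k)` moves half a derivative from the difference to the sum before
  -- Cauchy–Schwarz. The lost factor `lam k ^ 2` over `1 + lam k` is then at most `1 + lam k`, which
  -- the energy of the data absorbs.
  set f : ι → ℝ := fun k => lam k * inner ℝ (e k) (w t - u t) / √(1 + lam k) with hf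
  set g : ι → ℝ := fun k => √(1 + lam k) * (lam k * inner ℝ (e k) (w t + u t)) with hg
  have hfg : HasSum (fun k => f k * g k)
      (‖pow e lam (1 / 2) (w t)‖ ^ 2 - ‖pow e lam (1 / 2) (u t)‖ ^ 2) := by
    refine (hwt.sub hut).congr_fun fun k => ?_
    have : √(1 + lam k) ≠ 0 := (Real.sqrt_pos.2 (hl1 k)).ne'
    simp only [hf, hg, rpow_four_half, inner_sub_right, inner_add_right]
    field_simp
    ring
  have hfs := ((hasSum_energy hlam hd₀ hd₁).add
    ((hasSum_energy hlam hu₀ hu₁).mul_left (B ^ 2 / κ ^ 2))).mul_left X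
  have hgs := ((hasSum_energy hlam hw₀ hw₁).add (hasSum_energy hlam hu₀ hu₁)).mul_left (2 * C)
  have hfle : ∀ k, f k ^ 2 ≤ X * ((1 + lam k) * modeEnergy e lam (w₀ - u₀) (w₁ - u₁) k
      + B ^ 2 / κ ^ 2 * ((1 + lam k) * modeEnergy e lam u₀ u₁ k)) := by
    intro k
    have h1 := hw.sub_modeEnergy_le hlam hAe hν hν1 hM hL hc₁ hc₂ hu hκ hB hcc ht k
    have hz0 := modeEnergy_nonneg (e := e) (lam := lam) (w₀ - u₀) (w₁ - u₁) k
    have hq0 := modeEnergy_nonneg (e := e) (lam := lam) u₀ u₁ k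
    have h2 : lam k ^ 2 * inner ℝ (e k) (w t - u t) ^ 2
        ≤ modeEnergy e lam (w t - u t) (w' t - v t) k := by
      unfold modeEnergy; linarith [sq_nonneg (inner ℝ (e k) (w' t - v t))]
    simp only [hf]
    rw [div_pow, Real.sq_sqrt (hl1 k).le, div_le_iff₀ (hl1 k), mul_pow]
    refine (h2.trans h1).trans ?_
    rw [mul_assoc X]
    refine mul_le_mul_of_nonneg_left ?_ hX0
    have h3 : (1 : ℝ) ≤ (1 + lam k) * (1 + lam k) := by nlinarith [hlam k]
    have h4 : lam k ^ 2 ≤ (1 + lam k) * (1 + lam k) := by nlinarith [hlam k]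
    have h5 := mul_le_mul_of_nonneg_right h3 hz0
    have h6 := mul_le_mul_of_nonneg_left (mul_le_mul_of_nonneg_right h4 hq0)
      (by positivity : 0 ≤ B ^ 2 / κ ^ 2)
    linarith
  have hgle : ∀ k, g k ^ 2 ≤ 2 * C * ((1 + lam k) * modeEnergy e lam w₀ w₁ k
      + (1 + lam k) * modeEnergy e lam u₀ u₁ k) := by
    intro k
    have h1 := hw.modeEnergy_le hAe hν hν1 hM hL hc₁ ht k
    have h2 := hu.modeEnergy_le hAe hν hν1 hM hL hc₂ ht k
    have h3 : (inner ℝ (e k) (w t + u t)) ^ 2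
        ≤ 2 * (inner ℝ (e k) (w t) ^ 2 + inner ℝ (e k) (u t) ^ 2) := by
      rw [inner_add_right]
      nlinarith [sq_nonneg (inner ℝ (e k) (w t) - inner ℝ (e k) (u t))]
    have h4 := mul_le_mul_of_nonneg_left h3 (sq_nonneg (lam k))
    unfold modeEnergy at h1 h2
    have h5 : lam k ^ 2 * inner ℝ (e k) (w t + u t) ^ 2
        ≤ 2 * C * (modeEnergy e lam w₀ w₁ k + modeEnergy e lam u₀ u₁ k) := by
      unfold modeEnergy
      linarith [sq_nonneg (inner ℝ (e k) (w' t)), sq_nonneg (inner ℝ (e k) (v t))]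
    simp only [hg]
    rw [mul_pow, Real.sq_sqrt (hl1 k).le, mul_pow]
    refine (mul_le_mul_of_nonneg_left h5 (hl1 k).le).trans (le_of_eq ?_)
    ring
  have hfsq := hfs.summable.of_nonneg_of_le (fun k => sq_nonneg (f k)) hfle
  have hgsq := hgs.summable.of_nonneg_of_le (fun k => sq_nonneg (g k)) hgle
  have hF := hasSum_le hfle hfsq.hasSum hfs
  have hG := hasSum_le hgle hgsq.hasSum hgs
  have hcs := sq_le_mul_of_hasSum hfg hfsq.hasSum hgsq.hasSum
  have hG' : ∑' k, g k ^ 2 ≤ 4 * C * R := by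
    refine hG.trans ?_
    have := mul_le_mul_of_nonneg_left (add_le_add hwR huR) hC0
    linarith
  have hF' : ∑' k, f k ^ 2 ≤ X * (energy e lam (w₀ - u₀) (w₁ - u₁) + B ^ 2 / κ ^ 2 * R) := by
    refine hF.trans ?_
    gcongr
  have hZ := energy_nonneg (e := e) (lam := lam) (w₀ - u₀) (w₁ - u₁)
  calc _ ≤ (∑' k, f k ^ 2) * ∑' k, g k ^ 2 := hcs
    _ ≤ (X * (energy e lam (w₀ - u₀) (w₁ - u₁) + B ^ 2 / κ ^ 2 * R)) * (4 * C * R) :=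
      mul_le_mul hF' hG' (tsum_nonneg fun k => sq_nonneg _) (by positivity)
    _ = _ := by rw [hX]; ring

end Dependence

end Kirchhoff

/-! ### Bounds for the nonlinear coefficient map. -/

theorem ContDiffOn.exists_abs_sub_le_mul_abs_sub {m : ℝ → ℝ} (hm : ContDiffOn ℝ 1 m (Ici 0))
    (S : ℝ) : ∃ Λ : ℝ, 0 ≤ Λ ∧ ∀ a ∈ Icc 0 S, ∀ b ∈ Icc 0 S, |m a - m b| ≤ Λ * |a - b| := by
  have hd := hm.continuousOn_derivWithin (uniqueDiffOn_Ici 0) le_rfl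
  obtain ⟨C, hC⟩ := (isCompact_Icc (a := (0 : ℝ)) (b := S)).exists_bound_of_continuousOn
    (hd.mono Icc_subset_Ici_self)
  refine ⟨|C|, abs_nonneg _, fun a ha b hb => ?_⟩
  have hder : ∀ x ∈ Icc 0 S, HasDerivWithinAt m (derivWithin m (Ici 0) x) (Icc 0 S) x :=
    fun x hx => ((hm.differentiableOn one_ne_zero x
      (Icc_subset_Ici_self hx)).hasDerivWithinAt).mono Icc_subset_Ici_self
  exact (convex_Icc (0 : ℝ) S).norm_image_sub_le_of_norm_hasDerivWithin_le hder
    (fun x hx => (hC x hx).trans (le_abs_self C)) hb ha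

namespace Kirchhoff

theorem IsCoeff.mono {T ν M M' L L' : ℝ} {c : ℝ → ℝ} (h : IsCoeff T ν M L c) (hM : M ≤ M')
    (hL : L ≤ L') : IsCoeff T ν M' L' c :=
  ⟨h.lower, fun t ht => (h.upper t ht).trans hM, fun s hs t ht =>
    (h.lip s hs t ht).trans (mul_le_mul_of_nonneg_right hL (abs_nonneg _))⟩

theorem IsCoeff.congr {T ν M L : ℝ} {c c' : ℝ → ℝ} (h : IsCoeff T ν M L c)
    (hc : ∀ t ∈ Icc 0 T, c' t = c t) : IsCoeff T ν M L c' :=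
  ⟨fun t ht => by rw [hc t ht]; exact h.lower t ht,
    fun t ht => by rw [hc t ht]; exact h.upper t ht,
    fun s hs t ht => by rw [hc t ht, hc s hs]; exact h.lip s hs t ht⟩

theorem IsCoeff.of_tendsto {T ν M L : ℝ} {c : ℕ → ℝ → ℝ} {c' : ℝ → ℝ}
    (h : ∀ n, IsCoeff T ν M L (c n))
    (hc : ∀ t ∈ Icc 0 T, Tendsto (fun n => c n t) atTop (𝓝 (c' t))) : IsCoeff T ν M L c' :=
  ⟨fun t ht => ge_of_tendsto' (hc t ht) fun n => (h n).lower t ht,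
    fun t ht => le_of_tendsto' (hc t ht) fun n => (h n).upper t ht,
    fun s hs t ht => le_of_tendsto' ((hc t ht).sub (hc s hs)).abs fun n => (h n).lip s hs t ht⟩

/-- The estimates are for squares, so `1/4` here yields the contraction factor `1/2`. -/
theorem exists_large_rate (κ₀ : ℝ) {Q : ℝ} (hQ : 0 ≤ Q) :
    ∃ κ : ℝ, κ₀ ≤ κ ∧ 0 < κ ∧ Q / κ ^ 2 ≤ 1 / 4 := by
  refine ⟨max κ₀ (1 + 4 * Q), le_max_left _ _, ?_, ?_⟩
  · exact lt_of_lt_of_le (by linarith) (le_max_right _ _)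
  · have h := le_max_right κ₀ (1 + 4 * Q)
    set κ := max κ₀ (1 + 4 * Q)
    have h1 : 1 ≤ κ := by linarith
    rw [div_le_iff₀ (by positivity)]
    nlinarith

variable {H ι : Type*} [NormedAddCommGroup H] [InnerProductSpace ℝ H]
  {A : H →ₗ.[ℝ] H} {e : HilbertBasis ι ℝ H} {lam : ι → ℝ}
  {T ν M L Λ S : ℝ} {m c c₁ c₂ : ℝ → ℝ} {u₀ u₁ w₀ w₁ : H} {u v w w' : ℝ → H}

/-- The Lipschitz constant of the new coefficient depends only on norm bounds for the solution and
on `m`, not on that of the old coefficient; this is what allows an invariant set. -/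
theorem IsLinearSolution.isCoeff_of_bounds (hlam : ∀ k, 0 ≤ lam k)
    (h : IsLinearSolution A e lam c u₀ u₁ T u v) {U V : ℝ}
    (hU : ∀ t ∈ Icc 0 T, ‖pow e lam (3 / 4) (u t)‖ ≤ U)
    (hV : ∀ t ∈ Icc 0 T, ‖pow e lam (1 / 4) (v t)‖ ≤ V)
    (hS : ∀ t ∈ Icc 0 T, ‖pow e lam (1 / 2) (u t)‖ ^ 2 ≤ S) (hΛ : 0 ≤ Λ)
    (hmΛ : ∀ a ∈ Icc 0 S, ∀ b ∈ Icc 0 S, |m a - m b| ≤ Λ * |a - b|)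
    (hmν : ∀ σ, 0 ≤ σ → ν ≤ m σ) (hmM : ∀ σ ∈ Icc 0 S, m σ ≤ M) :
    IsCoeff T ν M (Λ * (2 * V * U)) fun t => m (‖pow e lam (1 / 2) (u t)‖ ^ 2) :=
  ⟨fun _ _ => hmν _ (sq_nonneg _), fun t ht => hmM _ ⟨sq_nonneg _, hS t ht⟩, fun s hs t ht =>
    (hmΛ _ ⟨sq_nonneg _, hS t ht⟩ _ ⟨sq_nonneg _, hS s hs⟩).trans (by
      rw [mul_assoc]
      exact mul_le_mul_of_nonneg_left (h.abs_sq_sub_sq_le hlam hU hV s hs t ht) hΛ)⟩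

theorem norm_pow_half_sq_le (hlam : ∀ k, 0 ≤ lam k) {z : H} (hz : z ∈ PowDomain e lam (3 / 4)) :
    ‖pow e lam (1 / 2) z‖ ^ 2 ≤ ‖z‖ ^ 2 + ‖pow e lam (3 / 4) z‖ ^ 2 := by
  refine hasSum_le (fun k => ?_) (hasSum_pow hlam (half_of_threeQuarters hlam hz))
    ((hasSum_inner_sq e z).add (hasSum_pow hlam hz))
  rw [rpow_four_half, rpow_four_threeQuarters, ← one_add_mul]
  refine mul_le_mul_of_nonneg_right ?_ (sq_nonneg _)
  nlinarith [hlam k, mul_nonneg (hlam k) (sq_nonneg (lam k - 1)), sq_nonneg (lam k - 1)]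

theorem IsLinearSolution.exists_bounds (hlam : ∀ k, 0 ≤ lam k)
    (h : IsLinearSolution A e lam c u₀ u₁ T u v) :
    ∃ U V N : ℝ, 0 ≤ U ∧ 0 ≤ V ∧ 0 ≤ N ∧ ∀ t ∈ Icc 0 T, ‖pow e lam (3 / 4) (u t)‖ ≤ U ∧
      ‖pow e lam (1 / 4) (v t)‖ ≤ V ∧ ‖pow e lam (1 / 2) (u t)‖ ≤ N := by
  obtain ⟨U, hU⟩ := isCompact_Icc.exists_bound_of_continuousOn h.regular.2.2
  obtain ⟨V, hV⟩ := isCompact_Icc.exists_bound_of_continuousOn h.regular_deriv.2.1.2.2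
  obtain ⟨N, hN⟩ := isCompact_Icc.exists_bound_of_continuousOn h.regular.2.1
  refine ⟨|U|, |V|, |N| + |U|, abs_nonneg _, abs_nonneg _, by positivity, fun t ht =>
    ⟨(hU t ht).trans (le_abs_self _), (hV t ht).trans (le_abs_self _), ?_⟩⟩
  refine abs_le_of_sq_le_sq' ?_ (by positivity) |>.2
  have h1 := norm_pow_half_sq_le hlam (h.regular.1 t ht)
  have h2 : ‖u t‖ ^ 2 ≤ |N| ^ 2 := by gcongr; exact (hN t ht).trans (le_abs_self _)
  have h3 : ‖pow e lam (3 / 4) (u t)‖ ^ 2 ≤ |U| ^ 2 := by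
    gcongr; exact (hU t ht).trans (le_abs_self _)
  nlinarith [mul_nonneg (abs_nonneg N) (abs_nonneg U)]

/-- The map from the coefficient to `m(|A^{1/2} u|²)` is Lipschitz in exponentially weighted
norms. -/
theorem IsLinearSolution.abs_coeff_sub_le (hlam : ∀ k, 0 ≤ lam k)
    (hAe : ∀ k, ∃ hk : e k ∈ A.domain, A ⟨e k, hk⟩ = lam k ^ 2 • e k)
    (hν : 0 < ν) (hν1 : ν ≤ 1) (hM : 1 ≤ M) (hL : 0 ≤ L)
    (hc₁ : IsCoeff T ν M L c₁) (hc₂ : IsCoeff T ν M L c₂)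
    (hw₀ : w₀ ∈ PowDomain e lam (3 / 4)) (hw₁ : w₁ ∈ PowDomain e lam (1 / 4))
    (hu₀ : u₀ ∈ PowDomain e lam (3 / 4)) (hu₁ : u₁ ∈ PowDomain e lam (1 / 4))
    (hw : IsLinearSolution A e lam c₁ w₀ w₁ T w w')
    (hu : IsLinearSolution A e lam c₂ u₀ u₁ T u v) {κ B R β : ℝ} (hκ : 2 * L / ν + 1 ≤ κ)
    (hB : 0 ≤ B) (hcc : ∀ t ∈ Icc 0 T, |c₁ t - c₂ t| ≤ B * Real.exp (κ * t))
    (hwR : energy e lam w₀ w₁ ≤ R) (huR : energy e lam u₀ u₁ ≤ R)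
    (hwS : ∀ t ∈ Icc 0 T, ‖pow e lam (1 / 2) (w t)‖ ^ 2 ≤ S)
    (huS : ∀ t ∈ Icc 0 T, ‖pow e lam (1 / 2) (u t)‖ ^ 2 ≤ S)
    (hmΛ : ∀ a ∈ Icc 0 S, ∀ b ∈ Icc 0 S, |m a - m b| ≤ Λ * |a - b|) (hβ : 0 ≤ β)
    (hsmall : Λ ^ 2 * (8 * growth T ν M L ^ 2 / ν * R) *
      (energy e lam (w₀ - u₀) (w₁ - u₁) + B ^ 2 / κ ^ 2 * R) ≤ β ^ 2) :
    ∀ t ∈ Icc 0 T, |m (‖pow e lam (1 / 2) (w t)‖ ^ 2) - m (‖pow e lam (1 / 2) (u t)‖ ^ 2)|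
      ≤ β * Real.exp (κ * t) := by
  intro t ht
  have h1 := hw.sq_sub_sq_le hlam hAe hν hν1 hM hL hc₁ hc₂ hw₀ hw₁ hu₀ hu₁ hu hκ hB hcc hwR huR ht
  have h2 := hmΛ _ ⟨sq_nonneg _, hwS t ht⟩ _ ⟨sq_nonneg _, huS t ht⟩
  have h3 : Real.exp (2 * κ * t) = Real.exp (κ * t) ^ 2 := by
    rw [← Real.exp_nat_mul]; congr 1; push_cast; ring
  refine abs_le_of_sq_le_sq ?_ (by positivity)
  calc _ ≤ (Λ * |‖pow e lam (1 / 2) (w t)‖ ^ 2 - ‖pow e lam (1 / 2) (u t)‖ ^ 2|) ^ 2 := by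
        rw [← sq_abs]; gcongr
    _ = Λ ^ 2 * (‖pow e lam (1 / 2) (w t)‖ ^ 2 - ‖pow e lam (1 / 2) (u t)‖ ^ 2) ^ 2 := by
        rw [mul_pow, sq_abs]
    _ ≤ Λ ^ 2 * (8 * growth T ν M L ^ 2 / ν * R *
        (energy e lam (w₀ - u₀) (w₁ - u₁) + B ^ 2 / κ ^ 2 * R) * Real.exp (2 * κ * t)) := by
        gcongr
    _ = Λ ^ 2 * (8 * growth T ν M L ^ 2 / ν * R) *
      (energy e lam (w₀ - u₀) (w₁ - u₁) + B ^ 2 / κ ^ 2 * R) * Real.exp (κ * t) ^ 2 := by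
        rw [h3]; ring
    _ ≤ β ^ 2 * Real.exp (κ * t) ^ 2 := by gcongr
    _ = _ := by ring

theorem energy_self_sub (z₀ z₁ : H) : energy e lam (z₀ - z₀) (z₁ - z₁) = 0 := by
  simp [energy, pow]

theorem exists_one_le_upper_bound {S : ℝ} {m : ℝ → ℝ} (hm : ContDiffOn ℝ 1 m (Ici 0)) :
    ∃ M : ℝ, 1 ≤ M ∧ ∀ σ ∈ Icc 0 S, m σ ≤ M := by
  obtain ⟨C, hC⟩ := (isCompact_Icc (a := (0 : ℝ)) (b := S)).exists_bound_of_continuousOn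
    (hm.continuousOn.mono Icc_subset_Ici_self)
  exact ⟨max 1 C, le_max_left _ _, fun σ hσ =>
    (le_abs_self _).trans ((hC σ hσ).trans (le_max_right _ _))⟩

/-! ### Uniqueness and stability for the nonlinear equation. -/

/-- Both coefficients are fixed by the same map, so each use of the contraction estimate halves the
bound on their difference. Equality of coefficients suffices for the stability result, which only
needs that every solution has the coefficient found by iteration. -/
theorem IsSolution.coeff_eq (hlam : ∀ k, 0 ≤ lam k)
    (hAe : ∀ k, ∃ hk : e k ∈ A.domain, A ⟨e k, hk⟩ = lam k ^ 2 • e k)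
    (hm : ContDiffOn ℝ 1 m (Ici 0)) (hν : 0 < ν) (hν1 : ν ≤ 1) (hmν : ∀ σ, 0 ≤ σ → ν ≤ m σ)
    (h₀ : u₀ ∈ PowDomain e lam (3 / 4)) (h₁ : u₁ ∈ PowDomain e lam (1 / 4))
    (hw : IsSolution A e lam m u₀ u₁ (Icc 0 T) w w')
    (hu : IsSolution A e lam m u₀ u₁ (Icc 0 T) u v) :
    ∀ t ∈ Icc 0 T, m (‖pow e lam (1 / 2) (w t)‖ ^ 2) = m (‖pow e lam (1 / 2) (u t)‖ ^ 2) := by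
  have hw' := hw.isLinearSolution
  have hu' := hu.isLinearSolution
  obtain ⟨U₁, V₁, N₁, hU₁0, hV₁0, hN₁0, hb₁⟩ := hw'.exists_bounds hlam
  obtain ⟨U₂, V₂, N₂, hU₂0, hV₂0, hN₂0, hb₂⟩ := hu'.exists_bounds hlam
  set S := (N₁ + N₂) ^ 2 with hS
  obtain ⟨Λ, hΛ, hmΛ⟩ := hm.exists_abs_sub_le_mul_abs_sub S
  obtain ⟨M, hM, hmM⟩ := exists_one_le_upper_bound (S := S) hm
  have hwS : ∀ t ∈ Icc 0 T, ‖pow e lam (1 / 2) (w t)‖ ^ 2 ≤ S := fun t ht => by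
    have := (hb₁ t ht).2.2
    simp only [hS]; gcongr; linarith
  have huS : ∀ t ∈ Icc 0 T, ‖pow e lam (1 / 2) (u t)‖ ^ 2 ≤ S := fun t ht => by
    have := (hb₂ t ht).2.2
    simp only [hS]; gcongr; linarith
  set L := Λ * (2 * (V₁ + V₂) * (U₁ + U₂)) with hL
  have hL0 : 0 ≤ L := by positivity
  have hc₁ := hw'.isCoeff_of_bounds hlam (U := U₁ + U₂) (V := V₁ + V₂)
    (fun t ht => (hb₁ t ht).1.trans (by linarith))
    (fun t ht => (hb₁ t ht).2.1.trans (by linarith)) hwS hΛ hmΛ hmν hmM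
  have hc₂ := hu'.isCoeff_of_bounds hlam (U := U₁ + U₂) (V := V₁ + V₂)
    (fun t ht => (hb₂ t ht).1.trans (by linarith))
    (fun t ht => (hb₂ t ht).2.1.trans (by linarith)) huS hΛ hmΛ hmν hmM
  set R := energy e lam u₀ u₁ with hR
  have hR0 : 0 ≤ R := energy_nonneg _ _
  set P := Λ ^ 2 * (8 * growth T ν M L ^ 2 / ν * R) with hP
  have hP0 : 0 ≤ P := by positivity
  obtain ⟨κ, hκ, hκ0, hκP⟩ := exists_large_rate (2 * L / ν + 1) (mul_nonneg hP0 hR0)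
  have key : ∀ n : ℕ, ∀ t ∈ Icc 0 T,
      |m (‖pow e lam (1 / 2) (w t)‖ ^ 2) - m (‖pow e lam (1 / 2) (u t)‖ ^ 2)|
        ≤ M / 2 ^ n * Real.exp (κ * t) := by
    intro n
    induction n with
    | zero =>
      intro t ht
      have h1 := hc₁.lower t ht
      have h2 := hc₁.upper t ht
      have h3 := hc₂.lower t ht
      have h4 := hc₂.upper t ht
      have h5 : 1 ≤ Real.exp (κ * t) := Real.one_le_exp (mul_nonneg hκ0.le ht.1)
      have h6 : |m (‖pow e lam (1 / 2) (w t)‖ ^ 2) - m (‖pow e lam (1 / 2) (u t)‖ ^ 2)| ≤ M :=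
        abs_le.2 ⟨by linarith, by linarith⟩
      rw [pow_zero, div_one]
      exact h6.trans (le_mul_of_one_le_right (by linarith) h5)
    | succ n ih =>
      have hMn : 0 ≤ M / 2 ^ n := by positivity
      refine hw'.abs_coeff_sub_le hlam hAe hν hν1 hM hL0 hc₁ hc₂ h₀ h₁ h₀ h₁ hu' hκ
        hMn ih le_rfl le_rfl hwS huS hmΛ (by positivity) ?_
      rw [energy_self_sub, zero_add]
      calc P * ((M / 2 ^ n) ^ 2 / κ ^ 2 * R) = P * R / κ ^ 2 * (M / 2 ^ n) ^ 2 := by ring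
        _ ≤ 1 / 4 * (M / 2 ^ n) ^ 2 := by gcongr
        _ = _ := by rw [pow_succ]; ring
  intro t ht
  have hlim : Tendsto (fun n : ℕ => M / 2 ^ n * Real.exp (κ * t)) atTop (𝓝 0) := by
    have h1 : Tendsto (fun n : ℕ => ((1 : ℝ) / 2) ^ n) atTop (𝓝 0) :=
      tendsto_pow_atTop_nhds_zero_of_lt_one (by norm_num) (by norm_num)
    have h2 := h1.const_mul (M * Real.exp (κ * t))
    rw [mul_zero] at h2
    refine h2.congr fun n => ?_
    rw [div_pow, one_pow]; ring
  have h0 := ge_of_tendsto' hlim fun n => key n t ht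
  exact sub_eq_zero.1 (abs_eq_zero.1 (le_antisymm h0 (abs_nonneg _)))

/-- Stability: data close to those of a solution on `[0, T]` have a solution on `[0, T]`, and all
such solutions are close to the given one. -/
theorem IsSolution.exists_stability_radius [CompleteSpace H] (hA : IsSelfAdjoint A)
    (hlam : ∀ k, 0 ≤ lam k)
    (hAe : ∀ k, ∃ hk : e k ∈ A.domain, A ⟨e k, hk⟩ = lam k ^ 2 • e k)
    (hm : ContDiffOn ℝ 1 m (Ici 0)) (hν : 0 < ν) (hν1 : ν ≤ 1) (hmν : ∀ σ, 0 ≤ σ → ν ≤ m σ)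
    (hT : 0 < T)
    (h₀ : u₀ ∈ PowDomain e lam (3 / 4)) (h₁ : u₁ ∈ PowDomain e lam (1 / 4))
    (hu : IsSolution A e lam m u₀ u₁ (Icc 0 T) u v) {δ : ℝ} (hδ : 0 < δ) :
    ∃ ζ > 0, ∀ w₀ w₁ : H, w₀ ∈ PowDomain e lam (3 / 4) → w₁ ∈ PowDomain e lam (1 / 4) →
      energy e lam (w₀ - u₀) (w₁ - u₁) ≤ ζ →
      (∃ w w' : ℝ → H, IsSolution A e lam m w₀ w₁ (Icc 0 T) w w') ∧
      ∀ w w' : ℝ → H, IsSolution A e lam m w₀ w₁ (Icc 0 T) w w' →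
        ∀ t ∈ Icc 0 T, energy e lam (w t - u t) (w' t - v t) < δ := by
  have hu' := hu.isLinearSolution
  obtain ⟨U, V, N, hU0, hV0, hN0, hb⟩ := hu'.exists_bounds hlam
  -- The constants are built from the bounds for `u` enlarged by 1, and so are fixed before any
  -- neighbouring solution is considered.
  set S := (N + 1) ^ 2 with hS
  obtain ⟨Λ, hΛ, hmΛ⟩ := hm.exists_abs_sub_le_mul_abs_sub S
  obtain ⟨M, hM, hmM⟩ := exists_one_le_upper_bound (S := S) hm
  set L := Λ * (2 * (V + 1) * (U + 1)) with hL
  have hL0 : 0 ≤ L := by positivity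
  set c : ℝ → ℝ := fun t => m (‖pow e lam (1 / 2) (u t)‖ ^ 2) with hc
  have huS : ∀ t ∈ Icc 0 T, ‖pow e lam (1 / 2) (u t)‖ ^ 2 ≤ S := fun t ht => by
    have := (hb t ht).2.2
    simp only [hS]; gcongr; linarith
  have hcu : IsCoeff T ν M L c := hu'.isCoeff_of_bounds hlam (U := U + 1) (V := V + 1)
    (fun t ht => (hb t ht).1.trans (by linarith))
    (fun t ht => (hb t ht).2.1.trans (by linarith)) huS hΛ hmΛ hmν hmM
  obtain ⟨η, hη, hnear⟩ := hu'.exists_energy_sub_lt hlam hAe hν hν1 hM hL0 hcu h₀ h₁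
    (lt_min hδ one_pos)
  set R := 2 * (1 + energy e lam u₀ u₁) with hR
  have hE0 : 0 ≤ energy e lam u₀ u₁ := energy_nonneg _ _
  have hR0 : 0 ≤ R := by positivity
  set P := Λ ^ 2 * (8 * growth T ν M L ^ 2 / ν * R) with hP
  have hP0 : 0 ≤ P := by positivity
  obtain ⟨κ, hκ, hκ0, hκP⟩ := exists_large_rate (2 * L / ν + 1) (mul_nonneg hP0 hR0)
  have hκP' : ∀ b : ℝ, P * (b ^ 2 / κ ^ 2 * R) ≤ 1 / 4 * b ^ 2 := fun b => by
    calc P * (b ^ 2 / κ ^ 2 * R) = P * R / κ ^ 2 * b ^ 2 := by ring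
      _ ≤ 1 / 4 * b ^ 2 := by gcongr
  -- The weighted radius `B` keeps the unweighted distance to `c` at most `η` up to time `T`, as the
  -- continuity statement `hnear` requires.
  set B := η * Real.exp (-(κ * T)) with hB
  have hB0 : 0 < B := by positivity
  have hBη : ∀ t ∈ Icc 0 T, B * Real.exp (κ * t) ≤ η := fun t ht => by
    rw [hB, mul_assoc, ← Real.exp_add]
    refine mul_le_of_le_one_right (le_of_lt hη) (Real.exp_le_one_iff.2 ?_)
    nlinarith [ht.2]
  -- For the invariance of the ball, the data contribute at most `3/4 * B²` and the coefficient
  -- difference at most `1/4 * B²`, in total `B²`.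
  refine ⟨min (min η 1) (3 / 4 * B ^ 2 / (P + 1)), lt_min (lt_min hη one_pos) (by positivity),
    fun w₀ w₁ hw₀ hw₁ hζ => ?_⟩
  have hζη : energy e lam (w₀ - u₀) (w₁ - u₁) ≤ η :=
    hζ.trans ((min_le_left _ _).trans (min_le_left _ _))
  have hζ1 : energy e lam (w₀ - u₀) (w₁ - u₁) ≤ 1 :=
    hζ.trans ((min_le_left _ _).trans (min_le_right _ _))
  have hζP : P * energy e lam (w₀ - u₀) (w₁ - u₁) ≤ 3 / 4 * B ^ 2 := by
    have h1 := hζ.trans (min_le_right _ _)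
    rw [le_div_iff₀ (by positivity)] at h1
    linarith [energy_nonneg (e := e) (lam := lam) (w₀ - u₀) (w₁ - u₁)]
  have hwR : energy e lam w₀ w₁ ≤ R :=
    (energy_le_sub_add hlam hw₀ hw₁ h₀ h₁).trans (by rw [hR]; linarith)
  have huR : energy e lam u₀ u₁ ≤ R := by rw [hR]; linarith
  set K : Set (ℝ → ℝ) :=
    {x | IsCoeff T ν M L x ∧ ∀ t ∈ Icc 0 T, |x t - c t| ≤ B * Real.exp (κ * t)} with hK
  have hsol : ∀ x ∈ K, ∃ w w' : ℝ → H, IsLinearSolution A e lam x w₀ w₁ T w w' := fun x hx =>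
    exists_isLinearSolution hA hlam hAe hν hν1 hM hL0 hT hx.1 hw₀ hw₁
  choose! W W' hW using hsol
  set Φ : (ℝ → ℝ) → ℝ → ℝ := fun x t => m (‖pow e lam (1 / 2) (W x t)‖ ^ 2) with hΦ
  -- A priori closeness to `u` at distance less than 1 yields the enlarged bounds, hence the
  -- constants `M` and `L` again for `Φ x`.
  have hWnear : ∀ x ∈ K, ∀ t ∈ Icc 0 T, energy e lam (W x t - u t) (W' x t - v t) < min δ 1 :=
    fun x hx => hnear x w₀ w₁ (W x) (W' x) hx.1 hw₀ hw₁ (hW x hx)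
      (fun t ht => (hx.2 t ht).trans (hBη t ht)) hζη
  have hWb : ∀ x ∈ K, ∀ t ∈ Icc 0 T, ‖pow e lam (3 / 4) (W x t)‖ ≤ U + 1 ∧
      ‖pow e lam (1 / 4) (W' x t)‖ ≤ V + 1 ∧ ‖pow e lam (1 / 2) (W x t)‖ ≤ N + 1 := by
    intro x hx t ht
    have h1 := (hWnear x hx t ht).trans_le (min_le_right _ _)
    have m3 := (hW x hx).regular.1 t ht
    have m1 := (hW x hx).regular_deriv.2.1.1 t ht
    have n3 := hu.regular.1 t ht
    have n1 := hu.regular_deriv.2.1.1 t ht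
    unfold energy at h1
    rw [pow_sub hlam m3 n3, pow_sub hlam m1 n1,
      pow_sub hlam (half_of_threeQuarters hlam m3) (half_of_threeQuarters hlam n3)] at h1
    have aux : ∀ {y z : H} {a : ℝ}, ‖y - z‖ ^ 2 ≤ 1 → ‖z‖ ≤ a → ‖y‖ ≤ a + 1 := by
      intro y z a h h'
      have h2 : ‖y - z‖ ≤ 1 := (sq_le_one_iff₀ (norm_nonneg _)).1 h
      have h3 := norm_add_le (y - z) z
      rw [sub_add_cancel] at h3
      linarith
    refine ⟨aux ?_ (hb t ht).1, aux ?_ (hb t ht).2.1, aux ?_ (hb t ht).2.2⟩ <;>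
    nlinarith [sq_nonneg ‖W' x t - v t‖,
      sq_nonneg ‖pow e lam (1 / 4) (W' x t) - pow e lam (1 / 4) (v t)‖,
      sq_nonneg ‖pow e lam (1 / 2) (W x t) - pow e lam (1 / 2) (u t)‖,
      sq_nonneg ‖pow e lam (3 / 4) (W x t) - pow e lam (3 / 4) (u t)‖]
  have hWS : ∀ x ∈ K, ∀ t ∈ Icc 0 T, ‖pow e lam (1 / 2) (W x t)‖ ^ 2 ≤ S := fun x hx t ht => by
    have := (hWb x hx t ht).2.2
    simp only [hS]; gcongr
  have hcK : c ∈ K := ⟨hcu, fun t _ => by rw [sub_self, abs_zero]; positivity⟩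
  have hmaps : ∀ x ∈ K, Φ x ∈ K := fun x hx =>
    ⟨(hW x hx).isCoeff_of_bounds hlam (fun t ht => (hWb x hx t ht).1)
        (fun t ht => (hWb x hx t ht).2.1) (hWS x hx) hΛ hmΛ hmν hmM,
      (hW x hx).abs_coeff_sub_le hlam hAe hν hν1 hM hL0 hx.1 hcu hw₀ hw₁ h₀ h₁ hu' hκ hB0.le hx.2
        hwR huR (hWS x hx) huS hmΛ hB0.le (by
          rw [← hP, mul_add]
          linarith [hκP' B])⟩
  obtain ⟨x, hx, hfix⟩ := exists_fixedPoint_of_halving (T := T) (κ := κ) hmaps hcK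
    (fun x hx y hy b hb hxy =>
      (hW x hx).abs_coeff_sub_le hlam hAe hν hν1 hM hL0 hx.1 hy.1 hw₀ hw₁ hw₀ hw₁ (hW y hy) hκ hb
        hxy hwR hwR (hWS x hx) (hWS y hy) hmΛ (by positivity) (by
          rw [← hP, energy_self_sub, zero_add]
          linarith [hκP' b]))
    ⟨B, hB0.le, fun t ht => by rw [abs_sub_comm]; exact (hmaps c hcK).2 t ht⟩
    (fun x y hx hxy => by
      have hpt : ∀ t ∈ Icc 0 T, Tendsto (fun n => x n t) atTop (𝓝 (y t)) := fun t ht =>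
        hxy.tendsto_at ht
      exact ⟨IsCoeff.of_tendsto (fun n => (hx n).1) hpt, fun t ht =>
        le_of_tendsto' ((hpt t ht).sub_const (c t)).abs fun n => (hx n).2 t ht⟩)
  have hWsol : IsSolution A e lam m w₀ w₁ (Icc 0 T) (W x) (W' x) := (hW x hx).isSolution hfix
  refine ⟨⟨W x, W' x, hWsol⟩, fun w w' hw t ht => ?_⟩
  have heq : ∀ t ∈ Icc 0 T, m (‖pow e lam (1 / 2) (w t)‖ ^ 2) = x t := fun t ht =>
    (hw.coeff_eq hlam hAe hm hν hν1 hmν hw₀ hw₁ hWsol t ht).trans (hfix t ht)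
  refine (hnear _ w₀ w₁ w w' (hx.1.congr heq) hw₀ hw₁ hw.isLinearSolution (fun t ht => ?_) hζη
    t ht).trans_le (min_le_left _ _)
  rw [heq t ht]
  exact (hx.2 t ht).trans (hBη t ht)

/-- The `A^{1/2}` term is not part of the graph norms; it is bounded by interpolation between `|z|`
and `|A^{3/4} z|`, hence the factor 2 on the last term. -/
theorem tendsto_energy_sub {X : Type*} {l : Filter X} {w₀ w₁ : X → H} (hlam : ∀ k, 0 ≤ lam k)
    (hw₀ : ∀ᶠ x in l, w₀ x ∈ PowDomain e lam (3 / 4))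
    (hw₁ : ∀ᶠ x in l, w₁ x ∈ PowDomain e lam (1 / 4))
    (h₀ : u₀ ∈ PowDomain e lam (3 / 4)) (h₁ : u₁ ∈ PowDomain e lam (1 / 4))
    (hlim₀ : TendstoPow e lam (3 / 4) w₀ l u₀) (hlim₁ : TendstoPow e lam (1 / 4) w₁ l u₁) :
    Tendsto (fun x => energy e lam (w₀ x - u₀) (w₁ x - u₁)) l (𝓝 0) := by
  have hsq : ∀ {f : X → H} {z : H}, Tendsto f l (𝓝 z) →
      Tendsto (fun x => ‖f x - z‖ ^ 2) l (𝓝 0) := fun h => by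
    simpa using (tendsto_iff_norm_sub_tendsto_zero.1 h).pow 2
  have hsum := (((hsq hlim₁.1).add (hsq hlim₁.2)).add (hsq hlim₀.1)).add
    ((hsq hlim₀.2).const_mul 2)
  simp only [mul_zero, add_zero] at hsum
  refine squeeze_zero' (Eventually.of_forall fun x => energy_nonneg _ _) ?_ hsum
  filter_upwards [hw₀, hw₁] with x hx₀ hx₁
  have h := norm_pow_half_sq_le hlam (sub_mem_powDomain hlam hx₀ h₀)
  unfold energy
  rw [pow_sub hlam hx₀ h₀] at h ⊢
  rw [pow_sub hlam hx₁ h₁]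
  linarith

end Kirchhoff

/-! ### The main theorem. -/

theorem corollary2p2
    {H ι : Type*} [NormedAddCommGroup H] [InnerProductSpace ℝ H] [CompleteSpace H] [Countable ι]
    (A : H →ₗ.[ℝ] H) (hA : IsSelfAdjoint A)
    (e : HilbertBasis ι ℝ H) (lam : ι → ℝ) (hlam : ∀ k, 0 ≤ lam k)
    (hAe : ∀ k, ∃ hk : e k ∈ A.domain, A ⟨e k, hk⟩ = lam k ^ 2 • e k)
    (m : ℝ → ℝ) (hm : ContDiffOn ℝ 1 m (Ici 0))
    (ν₀ : ℝ) (hν₀ : 0 < ν₀) (hmν : ∀ σ, 0 ≤ σ → ν₀ ≤ m σ)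
    (u₀ u₁ : H)
    (hu₀ : u₀ ∈ Kirchhoff.PowDomain e lam (3 / 4)) (hu₁ : u₁ ∈ Kirchhoff.PowDomain e lam (1 / 4))
    (u v : ℝ → H) (hu : Kirchhoff.IsSolution A e lam m u₀ u₁ (Ici 0) u v)
    (w₀ w₁ : ℝ → H)
    (hw₀ : ∀ ε, 0 < ε → w₀ ε ∈ Kirchhoff.PowDomain e lam (3 / 4))
    (hw₁ : ∀ ε, 0 < ε → w₁ ε ∈ Kirchhoff.PowDomain e lam (1 / 4))
    (hlim₀ : Kirchhoff.TendstoPow e lam (3 / 4) w₀ (𝓝[>] 0) u₀)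
    (hlim₁ : Kirchhoff.TendstoPow e lam (1 / 4) w₁ (𝓝[>] 0) u₁) :
    Tendsto (fun ε => Kirchhoff.lifeSpan A e lam m (w₀ ε) (w₁ ε)) (𝓝[>] 0) (𝓝 ⊤) ∧
    ∀ T : ℝ, 0 < T → ∀ δ : ℝ, 0 < δ → ∀ᶠ ε in 𝓝[>] (0 : ℝ),
      (∃ w w' : ℝ → H, Kirchhoff.IsSolution A e lam m (w₀ ε) (w₁ ε) (Icc 0 T) w w') ∧
      ∀ w w' : ℝ → H, Kirchhoff.IsSolution A e lam m (w₀ ε) (w₁ ε) (Icc 0 T) w w' →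
        ∀ t ∈ Icc 0 T, Kirchhoff.energy e lam (w t - u t) (w' t - v t) < δ := by
  have main : ∀ T : ℝ, 0 < T → ∀ δ : ℝ, 0 < δ → ∀ᶠ ε in 𝓝[>] (0 : ℝ),
      (∃ w w' : ℝ → H, Kirchhoff.IsSolution A e lam m (w₀ ε) (w₁ ε) (Icc 0 T) w w') ∧
      ∀ w w' : ℝ → H, Kirchhoff.IsSolution A e lam m (w₀ ε) (w₁ ε) (Icc 0 T) w w' →
        ∀ t ∈ Icc 0 T, Kirchhoff.energy e lam (w t - u t) (w' t - v t) < δ := by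
    intro T hT δ hδ
    -- The lower bound is replaced by `min ν₀ 1`, because the energy comparisons assume a constant
    -- at most 1.
    obtain ⟨ζ, hζ, h⟩ := (hu.mono Icc_subset_Ici_self).exists_stability_radius hA hlam hAe hm
      (lt_min hν₀ one_pos) (min_le_right ν₀ 1)
      (fun σ hσ => (min_le_left ν₀ 1).trans (hmν σ hσ)) hT hu₀ hu₁ hδ
    have hlim := Kirchhoff.tendsto_energy_sub hlam (eventually_nhdsWithin_of_forall hw₀)
      (eventually_nhdsWithin_of_forall hw₁) hu₀ hu₁ hlim₀ hlim₁
    filter_upwards [hlim.eventually_lt_const hζ, self_mem_nhdsWithin] with ε hε hε0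
    exact h _ _ (hw₀ ε hε0) (hw₁ ε hε0) hε.le
  refine ⟨ENNReal.tendsto_nhds_top fun n => ?_, main⟩
  -- Existence up to time `n + 1` makes the life span strictly larger than `n`.
  filter_upwards [main (n + 1) (by positivity) 1 one_pos] with ε hε
  refine lt_of_lt_of_le ?_ (le_sSup ⟨n + 1, by positivity, rfl, hε.1⟩)
  rw [ENNReal.ofReal_add (by positivity) zero_le_one, ENNReal.ofReal_natCast, ENNReal.ofReal_one]
  exact ENNReal.lt_add_right (ENNReal.natCast_ne_top n) one_ne_zero
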